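/- All graphs are finite, simple and without isolated vertices, and are considered up to isomorphism; the empty graph is written $1$. A partially labeled graph is a graph in which some of the vertices carry pairwise distinct labels from $\mathbb{N}$ (isomorphisms respect labels). Let $\mathcal{A}$ be the $\mathbb{R}$-algebra of formal finite real linear combinations of partially labeled graphs, where the product $H_1H_2$ is obtained by gluing vertices with the same label and keeping one copy of each doubled edge. Let $\mathcal{A}_\emptyset\subseteq\mathcal{A}$ be the subalgebra spanned by the unlabeled graphs (with disjoint union as product); its elements are called graph combinations. Let $[[\cdot]]:\mathcal{A}\to\mathcal{A}_\emptyset$ be the linear map that forgets labels. For an integer $d\ge 1$, let $\mathcal{V}_d$ be the (finite) set of nonempty connected unlabeled graphs of the form $[[AB]]$, where $A,B$ are partially labeled graphs with at most $d$ edges each. A $d$-sos graph combination is a finite sum $\sum_j[[a_j^2]]$ with $a_j\in\mathcal{A}$ such that every graph occurring in any $a_j$ has at most $d$ edges. If every connected component of every graph occurring in a graph combination $a$ lies in $\mathcal{V}_d$ (as is the case when $a$ is $d$-sos), then $a$ is a polynomial in the elements of $\mathcal{V}_d$, each graph being the product of its connected components, and $a(\mathbf{v})$ denotes its value at $\mathbf{v}\in\mathbb{R}^{\mathcal{V}_d}$.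 The $d$-sos-profile is $$\mathcal{S}_d=\{\mathbf{v}\in\mathbb{R}_{\ge 0}^{\mathcal{V}_d} : a(\mathbf{v})\ge 0 \text{ for all } d\text{-sos graph combinations } a\}.$$ A graph combination $a$ is sos-testable if for some $d\ge 1$ all connected components of the graphs occurring in $a$ lie in $\mathcal{V}_d$ and $a(\mathbf{v})\ge 0$ for all $\mathbf{v}\in\mathcal{S}_d$. Theorem. Let $a,b,c$ be graph combinations such that $b\ne 0$, $b$ and $c$ are sos-testable, and $ab=c$. Then $a$ is sos-testable. -/

import Mathlib

/-! ## Partially labeled graphs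

All graphs are finite, simple and have no isolated vertices.  Such a graph is determined by its
finite set of edges. A graph whose labels lie in `Λ` is a graph on the vertex universe `Λ ⊕ ℕ`:
the vertex `Sum.inl l` is the vertex that carries the label `l`, the vertices `Sum.inr n` are
unlabeled, and the vertices of the graph are those that are incident to an edge.  -/

/-- A concrete partially labeled graph with labels in `Λ` and without isolated vertices. -/
structure LGraph (Λ : Type) where
  graph : SimpleGraph (Λ ⊕ ℕ)
  finite_edges : graph.edgeSet.Finite

namespace LGraph

/-- Isomorphism of partially labeled graphs: an isomorphism that respects the labels.
(An isomorphism between the finite sets of non-isolated vertices always extends to the whole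
vertex universe.) -/
def Isom {Λ : Type} (G H : LGraph Λ) : Prop :=
  ∃ φ : G.graph ≃g H.graph, ∀ l : Λ, φ (Sum.inl l) = Sum.inl l

theorem isom_equivalence (Λ : Type) : Equivalence (Isom (Λ := Λ)) where
  refl G := ⟨SimpleGraph.Iso.refl, fun _ => rfl⟩
  symm := by
    rintro G H ⟨φ, hφ⟩
    exact ⟨φ.symm, fun l => by rw [RelIso.symm_apply_eq, hφ l]⟩
  trans := by
    rintro G H K ⟨φ, hφ⟩ ⟨ψ, hψ⟩
    exact ⟨φ.trans ψ, fun l => by simp [hφ, hψ]⟩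

instance instSetoid (Λ : Type) : Setoid (LGraph Λ) := ⟨Isom, isom_equivalence Λ⟩

theorem exists_perm {X : Type} {s : Set X} (hs : s.Finite) (e f : X → ℕ)
    (he : Set.InjOn e s) (hf : Set.InjOn f s) :
    ∃ σ : Equiv.Perm ℕ, ∀ x ∈ s, σ (e x) = f x := by
  have := hs.fintype
  obtain ⟨σ, hσ⟩ := (Equiv.Perm.isMultiplyPretransitive ℕ (Fintype.card s)).exists_smul_eq
    ((Fintype.equivFin s).symm.toEmbedding.trans ⟨fun x => e x, he.injective⟩)
    ((Fintype.equivFin s).symm.toEmbedding.trans ⟨fun x => f x, hf.injective⟩)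
  refine ⟨σ, fun x hx => ?_⟩
  have := DFunLike.congr_fun hσ (Fintype.equivFin s ⟨x, hx⟩)
  simp only [Function.Embedding.smul_apply, Function.Embedding.trans_apply,
    Equiv.coe_toEmbedding, Equiv.symm_apply_apply] at this
  exact this

theorem support_finite {V : Type} {K : SimpleGraph V} (h : K.edgeSet.Finite) :
    K.support.Finite := by
  refine ((h.biUnion (t := fun e => {v | v ∈ e})) fun e _ => ?_).subset ?_
  · induction e with
    | _ a b => exact (Set.toFinite {a, b}).subset (by intro v; simp)
  · rintro v ⟨w, hw⟩
    simp only [Set.mem_iUnion]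
    exact ⟨s(v, w), hw, by simp⟩

theorem map_edges_finite {V W : Type} {K : SimpleGraph V} (h : K.edgeSet.Finite) (f : V → W) :
    (K.map f).edgeSet.Finite := by
  refine (h.image (Sym2.map f)).subset ?_
  intro e
  induction e with
  | _ a b =>
    rintro ⟨-, u, v, huv, rfl, rfl⟩
    exact ⟨s(u, v), huv, rfl⟩

/-- Two injective placements of the same finite graph that use the same labels are isomorphic. -/
theorem isom_of_map {Λ Y : Type} (K : SimpleGraph Y) (hK : K.edgeSet.Finite) (f g : Y → Λ ⊕ ℕ)
    (hf : Function.Injective f) (hg : Function.Injective g)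
    (h : ∀ y l, f y = Sum.inl l ↔ g y = Sum.inl l) (G H : LGraph Λ)
    (hG : G.graph = K.map f) (hH : H.graph = K.map g) : G ≈ H := by
  have hr : ∀ y n, f y = Sum.inr n → ∃ m, g y = Sum.inr m := by
    intro y n hn
    rcases hgy : g y with l | m
    · rw [← h, hn] at hgy
      cases hgy
    · exact ⟨m, rfl⟩
  let num : Λ ⊕ ℕ → ℕ := Sum.elim (fun _ => 0) id
  obtain ⟨σ, hσ⟩ := exists_perm (s := {y | y ∈ K.support ∧ ∃ n, f y = Sum.inr n})
    ((support_finite hK).subset fun y hy => hy.1) (num ∘ f) (num ∘ g)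
    (by
      rintro x ⟨-, n, hn⟩ y ⟨-, m, hm⟩ hxy
      apply hf
      simp only [Function.comp, hn, hm, num] at hxy
      rw [hn, hm]
      exact congrArg _ hxy)
    (by
      rintro x ⟨-, n, hn⟩ y ⟨-, m, hm⟩ hxy
      obtain ⟨n', hn'⟩ := hr _ _ hn
      obtain ⟨m', hm'⟩ := hr _ _ hm
      apply hg
      simp only [Function.comp, hn', hm', num] at hxy
      rw [hn', hm']
      exact congrArg _ hxy)
  let τ : Λ ⊕ ℕ ≃ Λ ⊕ ℕ := Equiv.sumCongr (Equiv.refl Λ) σ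
  have hτ : ∀ y ∈ K.support, τ (f y) = g y := by
    intro y hy
    rcases hfy : f y with l | n
    · simp [τ, (h y l).1 hfy]
    · obtain ⟨m, hm⟩ := hr _ _ hfy
      have := hσ y ⟨hy, n, hfy⟩
      simp only [Function.comp, hfy, hm, num] at this
      rw [hm]
      exact congrArg Sum.inr this
  have key : H.graph = G.graph.map τ := by
    rw [hG, hH, SimpleGraph.map_map]
    ext a b
    simp only [SimpleGraph.map_adj', Function.comp]
    refine and_congr_right fun _ => ⟨?_, ?_⟩
    · rintro ⟨u, v, huv, rfl, rfl⟩
      exact ⟨u, v, huv, hτ u ⟨v, huv⟩, hτ v ⟨u, huv.symm⟩⟩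
    · rintro ⟨u, v, huv, rfl, rfl⟩
      exact ⟨u, v, huv, (hτ u ⟨v, huv⟩).symm, (hτ v ⟨u, huv.symm⟩).symm⟩
  refine ⟨⟨τ, ?_⟩, fun l => rfl⟩
  intro a b
  rw [key]
  exact SimpleGraph.map_adj_apply (f := τ.toEmbedding)

/-- Gluing two graphs along equal labels: vertices with the same label are identified, doubled
edges are kept once, and the unlabeled vertices are kept apart. -/
def glue {Λ X Y : Type} (G : SimpleGraph (Λ ⊕ X)) (H : SimpleGraph (Λ ⊕ Y)) :
    SimpleGraph (Λ ⊕ (X ⊕ Y)) :=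
  G.map (Sum.map id Sum.inl) ⊔ H.map (Sum.map id Sum.inr)

theorem sup_edges_finite {V : Type} {G H : SimpleGraph V} (hG : G.edgeSet.Finite)
    (hH : H.edgeSet.Finite) : (G ⊔ H).edgeSet.Finite := by
  rw [SimpleGraph.edgeSet_sup]
  exact hG.union hH

theorem glue_edges_finite {Λ X Y : Type} {G : SimpleGraph (Λ ⊕ X)} {H : SimpleGraph (Λ ⊕ Y)}
    (hG : G.edgeSet.Finite) (hH : H.edgeSet.Finite) : (glue G H).edgeSet.Finite :=
  sup_edges_finite (map_edges_finite hG _) (map_edges_finite hH _)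

/-- The gluing product of two partially labeled graphs (the unlabeled vertices are renumbered
by the bijection `ℕ ⊕ ℕ ≃ ℕ`). -/
def mul {Λ : Type} (G H : LGraph Λ) : LGraph Λ where
  graph := (glue G.graph H.graph).map (Sum.map id Equiv.natSumNatEquivNat)
  finite_edges := map_edges_finite (glue_edges_finite G.finite_edges H.finite_edges) _

/-- The empty graph. -/
def one (Λ : Type) : LGraph Λ where
  graph := ⊥
  finite_edges := by simp

theorem map_sup_graph {V W : Type} (f : V → W) (G H : SimpleGraph V) :
    (G ⊔ H).map f = G.map f ⊔ H.map f := by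
  ext a b
  simp only [SimpleGraph.map_adj', SimpleGraph.sup_adj]
  constructor
  · rintro ⟨hne, u, v, h | h, hu, hv⟩
    · exact Or.inl ⟨hne, u, v, h, hu, hv⟩
    · exact Or.inr ⟨hne, u, v, h, hu, hv⟩
  · rintro (⟨hne, u, v, h, hu, hv⟩ | ⟨hne, u, v, h, hu, hv⟩)
    · exact ⟨hne, u, v, Or.inl h, hu, hv⟩
    · exact ⟨hne, u, v, Or.inr h, hu, hv⟩

theorem sumMap_inl_iff {Λ X Y : Type} (p : X → Y) (y : Λ ⊕ X) (l : Λ) :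
    Sum.map id p y = Sum.inl l ↔ y = Sum.inl l := by
  cases y <;> simp

theorem sumMap_injective {Λ X Y : Type} {p : X → Y} (hp : Function.Injective p) :
    Function.Injective (Sum.map (id : Λ → Λ) p) :=
  Sum.map_injective.2 ⟨Function.injective_id, hp⟩

/-- The special case of `isom_of_map` for placements of the unlabeled vertices. -/
theorem isom_of_sumMap {Λ X : Type} (K : SimpleGraph (Λ ⊕ X)) (hK : K.edgeSet.Finite)
    (p q : X → ℕ) (hp : Function.Injective p) (hq : Function.Injective q) (G H : LGraph Λ)
    (hG : G.graph = K.map (Sum.map id p)) (hH : H.graph = K.map (Sum.map id q)) : G ≈ H :=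
  isom_of_map K hK _ _ (sumMap_injective hp) (sumMap_injective hq)
    (fun y l => by rw [sumMap_inl_iff, sumMap_inl_iff]) G H hG hH

theorem graph_eq_of_isom {Λ : Type} {G H : LGraph Λ} (h : G ≈ H) :
    ∃ σ : Equiv.Perm ℕ, H.graph = G.graph.map (Sum.map id σ) := by
  obtain ⟨φ, hφ⟩ := h
  have hinr : ∀ n, ∃ m, φ (Sum.inr n) = Sum.inr m := by
    intro n
    rcases h : φ (Sum.inr n) with l | m
    · rw [← hφ l] at h
      cases φ.injective h
    · exact ⟨m, rfl⟩
  choose s hs using hinr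
  have hbij : Function.Bijective s := by
    constructor
    · intro a b hab
      have : φ (Sum.inr a) = φ (Sum.inr b) := by rw [hs, hs, hab]
      exact Sum.inr_injective (φ.injective this)
    · intro m
      obtain ⟨x, hx⟩ := φ.surjective (Sum.inr m)
      rcases x with l | n
      · rw [hφ] at hx
        cases hx
      · exact ⟨n, Sum.inr_injective ((hs n).symm.trans hx)⟩
  refine ⟨Equiv.ofBijective s hbij, ?_⟩
  have hfun : Sum.map id (Equiv.ofBijective s hbij) = φ := by
    funext x
    rcases x with l | n
    · exact (hφ l).symm
    · exact (hs n).symm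
  rw [hfun]
  ext a b
  rw [SimpleGraph.map_adj']
  constructor
  · intro h
    exact ⟨h.ne, φ.symm a, φ.symm b, φ.symm.map_adj_iff.2 h, by simp, by simp⟩
  · rintro ⟨-, u, v, huv, rfl, rfl⟩
    exact φ.map_adj_iff.2 huv

theorem mul_congr {Λ : Type} (G G' H H' : LGraph Λ) (hG : G ≈ G') (hH : H ≈ H') :
    mul G H ≈ mul G' H' := by
  obtain ⟨σ, hσ⟩ := graph_eq_of_isom hG
  obtain ⟨τ, hτ⟩ := graph_eq_of_isom hH
  refine isom_of_sumMap (glue G.graph H.graph) (glue_edges_finite G.finite_edges H.finite_edges)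
    Equiv.natSumNatEquivNat (fun x => Equiv.natSumNatEquivNat (Equiv.sumCongr σ τ x))
    (Equiv.injective _) ((Equiv.injective _).comp (Equiv.injective _)) _ _ rfl ?_
  simp only [mul, glue, hσ, hτ, map_sup_graph, SimpleGraph.map_map, Sum.map_comp_map]
  rfl

theorem mul_comm_isom {Λ : Type} (G H : LGraph Λ) : mul G H ≈ mul H G := by
  refine isom_of_sumMap (glue G.graph H.graph) (glue_edges_finite G.finite_edges H.finite_edges)
    Equiv.natSumNatEquivNat (fun x => Equiv.natSumNatEquivNat (Equiv.sumComm ℕ ℕ x))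
    (Equiv.injective _) ((Equiv.injective _).comp (Equiv.injective _)) _ _ rfl ?_
  simp only [mul, glue, map_sup_graph, SimpleGraph.map_map, Sum.map_comp_map]
  rw [sup_comm]
  rfl

theorem mul_assoc_isom {Λ : Type} (G H K : LGraph Λ) :
    mul (mul G H) K ≈ mul G (mul H K) := by
  refine isom_of_sumMap (glue (glue G.graph H.graph) K.graph)
    (glue_edges_finite (glue_edges_finite G.finite_edges H.finite_edges) K.finite_edges)
    (fun x => Equiv.natSumNatEquivNat (Equiv.sumCongr Equiv.natSumNatEquivNat (Equiv.refl ℕ) x))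
    (fun x => Equiv.natSumNatEquivNat (Equiv.sumCongr (Equiv.refl ℕ) Equiv.natSumNatEquivNat
      (Equiv.sumAssoc ℕ ℕ ℕ x)))
    ((Equiv.injective _).comp (Equiv.injective _))
    ((Equiv.injective _).comp ((Equiv.injective _).comp (Equiv.injective _))) _ _ ?_ ?_
  · simp only [mul, glue, map_sup_graph, SimpleGraph.map_map, Sum.map_comp_map]
    rfl
  · simp only [mul, glue, map_sup_graph, SimpleGraph.map_map, Sum.map_comp_map]
    rw [sup_assoc]
    rfl

theorem one_mul_isom {Λ : Type} (G : LGraph Λ) : mul (one Λ) G ≈ G := by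
  refine isom_of_sumMap G.graph G.finite_edges
    (fun n => Equiv.natSumNatEquivNat (Sum.inr n)) id
    ((Equiv.injective _).comp Sum.inr_injective) Function.injective_id _ _ ?_ ?_
  · have hbot : ∀ f : Λ ⊕ ℕ → Λ ⊕ (ℕ ⊕ ℕ), (⊥ : SimpleGraph (Λ ⊕ ℕ)).map f = ⊥ := by
      intro f
      ext a b
      simp [SimpleGraph.map_adj']
    simp only [mul, glue, one, hbot, bot_sup_eq, SimpleGraph.map_map, Sum.map_comp_map]
    rfl
  · simp

/-- Forgetting the labels. -/
def unlabel (G : LGraph ℕ) : LGraph Empty where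
  graph := G.graph.map fun x => Sum.inr (Equiv.natSumNatEquivNat x)
  finite_edges := map_edges_finite G.finite_edges _

theorem unlabel_congr (G H : LGraph ℕ) (h : G ≈ H) : unlabel G ≈ unlabel H := by
  obtain ⟨σ, hσ⟩ := graph_eq_of_isom h
  refine isom_of_map G.graph G.finite_edges
    (fun x => Sum.inr (Equiv.natSumNatEquivNat x))
    (fun x => Sum.inr (Equiv.natSumNatEquivNat (Equiv.sumCongr (Equiv.refl ℕ) σ x)))
    (Sum.inr_injective.comp (Equiv.injective _))
    (Sum.inr_injective.comp ((Equiv.injective _).comp (Equiv.injective _)))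
    (fun _ l => l.elim) _ _ rfl ?_
  simp only [unlabel, hσ, SimpleGraph.map_map]
  rfl

/-- The number of edges. -/
noncomputable def numEdges {Λ : Type} (G : LGraph Λ) : ℕ := G.graph.edgeSet.ncard

theorem numEdges_congr {Λ : Type} (G H : LGraph Λ) (h : G ≈ H) : G.numEdges = H.numEdges := by
  obtain ⟨φ, -⟩ := h
  exact Nat.card_congr φ.mapEdgeSet

/-- The graph (without isolated vertices) is connected; the empty graph does not count as
connected. -/
def Conn {Λ : Type} (G : LGraph Λ) : Prop :=
  G.graph.support.Nonempty ∧
    ∀ u ∈ G.graph.support, ∀ v ∈ G.graph.support, G.graph.Reachable u v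

theorem mem_support_iso {V W : Type} {G : SimpleGraph V} {H : SimpleGraph W} (φ : G ≃g H)
    {u : V} (hu : u ∈ G.support) : φ u ∈ H.support := by
  obtain ⟨v, hv⟩ := hu
  exact ⟨φ v, φ.map_adj_iff.2 hv⟩

theorem conn_of_isom {Λ : Type} (G H : LGraph Λ) (h : G ≈ H) (hG : G.Conn) : H.Conn := by
  obtain ⟨φ, -⟩ := h
  obtain ⟨⟨x, hx⟩, hr⟩ := hG
  refine ⟨⟨φ x, mem_support_iso φ hx⟩, fun u hu v hv => ?_⟩
  have := hr _ (mem_support_iso φ.symm hu) _ (mem_support_iso φ.symm hv)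
  exact φ.symm.reachable_iff.1 this

/-- The connected component `c` of `G`, as a graph of its own: the edges of `G` inside `c`. -/
def componentGraph {Λ : Type} (G : LGraph Λ) (c : G.graph.ConnectedComponent) : LGraph Λ where
  graph :=
    { Adj := fun u v => G.graph.Adj u v ∧ G.graph.connectedComponentMk u = c
      symm := ⟨fun _ _ h => ⟨h.1.symm,
        (SimpleGraph.ConnectedComponent.connectedComponentMk_eq_of_adj h.1.symm).trans h.2⟩⟩
      loopless := ⟨fun _ h => h.1.ne rfl⟩ }
  finite_edges := G.finite_edges.subset (SimpleGraph.edgeSet_mono fun _ _ h => h.1)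

/-- The connected components of `G` that contain an edge, i.e. those which are components of the
graph once the isolated points of the vertex universe are disregarded. -/
noncomputable def nontrivialComponents {Λ : Type} (G : LGraph Λ) :
    Finset G.graph.ConnectedComponent :=
  ((support_finite G.finite_edges).image G.graph.connectedComponentMk).toFinset

/-- The multiset of the isomorphism types of the connected components of `G`. -/
noncomputable def components {Λ : Type} (G : LGraph Λ) : Multiset (Quotient (instSetoid Λ)) :=
  G.nontrivialComponents.val.map fun c => ⟦G.componentGraph c⟧

theorem components_congr {Λ : Type} (G H : LGraph Λ) (h : G ≈ H) :
    G.components = H.components := by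
  obtain ⟨φ, hφ⟩ := h
  have hval : H.nontrivialComponents.val =
      G.nontrivialComponents.val.map φ.connectedComponentEquiv := by
    have : H.nontrivialComponents =
        G.nontrivialComponents.map φ.connectedComponentEquiv.toEmbedding := by
      ext c
      simp only [nontrivialComponents, Set.Finite.mem_toFinset, Set.mem_image, Finset.mem_map]
      constructor
      · rintro ⟨u, hu, rfl⟩
        refine ⟨_, ⟨φ.symm u, mem_support_iso φ.symm hu, rfl⟩, ?_⟩
        simp
      · rintro ⟨_, ⟨u, hu, rfl⟩, rfl⟩
        exact ⟨φ u, mem_support_iso φ hu, by simp⟩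
    rw [this]
    rfl
  rw [components, components, hval, Multiset.map_map]
  refine Multiset.map_congr rfl fun c _ => Quotient.sound ?_
  refine ⟨⟨φ.toEquiv, ?_⟩, hφ⟩
  intro a b
  have hc : H.graph.connectedComponentMk (φ a) = φ.connectedComponentEquiv c ↔
      G.graph.connectedComponentMk a = c := by
    rw [← φ.connectedComponentEquiv.injective.eq_iff]
    simp
  exact and_congr φ.map_adj_iff hc

end LGraph

/-- Partially labeled graphs with labels in `Λ`, up to isomorphism. -/
def PLGraph (Λ : Type) : Type := Quotient (LGraph.instSetoid Λ)

namespace PLGraph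

/-- The gluing product, with the empty graph as its unit. For unlabeled graphs (`Λ = Empty`) it
is the disjoint union. -/
noncomputable instance instCommMonoid (Λ : Type) : CommMonoid (PLGraph Λ) where
  mul := Quotient.map₂ LGraph.mul fun _ _ hG _ _ hH => LGraph.mul_congr _ _ _ _ hG hH
  one := Quotient.mk _ (LGraph.one Λ)
  mul_assoc := by
    rintro ⟨G⟩ ⟨H⟩ ⟨K⟩
    exact Quotient.sound (LGraph.mul_assoc_isom G H K)
  mul_comm := by
    rintro ⟨G⟩ ⟨H⟩
    exact Quotient.sound (LGraph.mul_comm_isom G H)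
  one_mul := by
    rintro ⟨G⟩
    exact Quotient.sound (LGraph.one_mul_isom G)
  mul_one := by
    rintro ⟨G⟩
    exact Quotient.sound
      ((LGraph.isom_equivalence Λ).trans (LGraph.mul_comm_isom _ _) (LGraph.one_mul_isom G))

/-- Forgetting the labels. -/
def unlabel : PLGraph ℕ → PLGraph Empty :=
  Quotient.map LGraph.unlabel LGraph.unlabel_congr

/-- The number of edges. -/
noncomputable def numEdges {Λ : Type} : PLGraph Λ → ℕ :=
  Quotient.lift LGraph.numEdges LGraph.numEdges_congr

/-- Connectedness (the empty graph is not connected). -/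
def Conn {Λ : Type} : PLGraph Λ → Prop :=
  Quotient.lift LGraph.Conn fun G H h => propext
    ⟨LGraph.conn_of_isom G H h,
      LGraph.conn_of_isom H G ((LGraph.isom_equivalence Λ).symm h)⟩

/-- The multiset of connected components. -/
noncomputable def components {Λ : Type} : PLGraph Λ → Multiset (PLGraph Λ) :=
  Quotient.lift LGraph.components LGraph.components_congr

end PLGraph

/-! ## Graph combinations -/

/-- The gluing algebra: formal finite real linear combinations of partially labeled graphs
without isolated vertices, with the gluing product. -/
abbrev LabeledComb : Type := MonoidAlgebra ℝ (PLGraph ℕ)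

/-- Graph combinations: formal finite real linear combinations of unlabeled graphs without
isolated vertices, multiplied by disjoint union. -/
abbrev GraphComb : Type := MonoidAlgebra ℝ (PLGraph Empty)

/-- The linear unlabeling map. -/
noncomputable def LabeledComb.unlabel (a : LabeledComb) : GraphComb :=
  MonoidAlgebra.mapDomain PLGraph.unlabel a

namespace GraphComb

/-- The value of a graph combination when every connected graph `C` is given the value `v C`:
a graph takes the product of the values of its connected components. -/
noncomputable def eval (v : PLGraph Empty → ℝ) (a : GraphComb) : ℝ :=
  a.coeff.sum fun H α => α * (H.components.map v).prod

/-- `a = ∑ [[f_j ^ 2]]`, where all constituent graphs of all `f_j` have at most `d` edges. -/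
def IsSos (d : ℕ) (a : GraphComb) : Prop :=
  ∃ (n : ℕ) (f : Fin n → LabeledComb),
    (∀ j, ∀ H ∈ (f j).coeff.support, H.numEdges ≤ d) ∧
      a = ∑ j, LabeledComb.unlabel (f j ^ 2)

end GraphComb

/-- The connected graphs `[[A B]]` where `A`, `B` are partially labeled graphs with at most `d`
edges. -/
def sosGraphs (d : ℕ) : Set (PLGraph Empty) :=
  {C | C.Conn ∧ ∃ A B : PLGraph ℕ, A.numEdges ≤ d ∧ B.numEdges ≤ d ∧ C = (A * B).unlabel}

/-- The value of a graph combination at a point with coordinates indexed by `sosGraphs d`. It is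
only meant for combinations in which every component of every constituent graph lies in
`sosGraphs d`, as is the case for `d`-sos graph combinations, so that the default value `0` of the
other coordinates plays no role. -/
noncomputable def GraphComb.evalAt {d : ℕ} (v : sosGraphs d → ℝ) (a : GraphComb) : ℝ :=
  a.eval (Function.extend Subtype.val v 0)

/-- The `d`-sos-profile. -/
def sosProfile (d : ℕ) : Set (sosGraphs d → ℝ) :=
  {v | (∀ C, 0 ≤ v C) ∧ ∀ a : GraphComb, a.IsSos d → 0 ≤ a.evalAt v}

/-- A graph combination is sos-testable if, for some `d`, it is a polynomial in the coordinates
of the `d`-sos-profile that is nonnegative on the `d`-sos-profile. -/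
def GraphComb.IsSosTestable (a : GraphComb) : Prop :=
  ∃ d : ℕ, 1 ≤ d ∧ (∀ H ∈ a.coeff.support, ∀ C ∈ H.components, C ∈ sosGraphs d) ∧
    ∀ v ∈ sosProfile d, 0 ≤ a.evalAt v

/-! A point of the `d`-sos-profile is the same thing as a multiplicative graph parameter `u` that is
nonnegative and whose form `(A, B) ↦ u [[AB]]` is positive semidefinite on labeled graphs with at
most `d` edges; only the values on `sosGraphs d` matter. The set of these parameters is not convex,
but each of them can be joined to many others by a polynomial path, and the theorem follows by
continuity along such a path.

The path comes from random colouring. Colour the vertices of a graph independently with weights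
summing to 1, discard the colourings in which some edge joins incompatible colours, and average `u`
of the subgraph spanned by one fixed colour class. The average is multiplicative over disjoint
unions and ignores isolated vertices. It is again positive semidefinite in degree `d`: once the
colours of the labeled vertices are fixed, the moment form is a form of `u` on colour classes, which
have no more edges than before (`IsReflPos.mixHom`).

Give weight `1 - θ` to the colour that carries `u`, and the remaining weight `θ` to the vertices of
a graph `H₀` and to one dead colour. This yields parameters `pathHom H₀ u q θ` that lie in the
profile for `0 ≤ θ ≤ 1`, equal `u` at `θ = 0`, and equal a weighted homomorphism density of `H₀` at
`θ = 1`. Since `b ≠ 0`, the graph `H₀` and its weights can be chosen so that `b` does not vanish at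
`θ = 1` (`exists_pathHom_one_ne_zero`). Along the path `a` and `b` become polynomials `P` and `Q` in
`θ` with `Q ≠ 0`, `Q ≥ 0` and `P * Q ≥ 0` on `[0, 1]`. As `Q` has finitely many zeros, `P ≥ 0` at
points arbitrarily close to 0, hence `P(0) ≥ 0`, which is the value of `a` at `u`. -/

namespace LGraph

/-! ### Placements in the vertex universe and disjoint unions -/

/-- The partially labeled graph obtained from a finite graph by placing its vertices in the vertex
universe. -/
def place {Λ Y : Type} (K : SimpleGraph Y) (hK : K.edgeSet.Finite) (f : Y → Λ ⊕ ℕ) : LGraph Λ where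
  graph := K.map f
  finite_edges := map_edges_finite hK f

/-- Two placements of the same finite graph are isomorphic if they are injective on its vertices
and use the same labels. -/
theorem place_isom {Λ Y : Type} (K : SimpleGraph Y) (hK : K.edgeSet.Finite) (f g : Y → Λ ⊕ ℕ)
    (hf : Set.InjOn f K.support) (hg : Set.InjOn g K.support)
    (h : ∀ y ∈ K.support, ∀ l, f y = Sum.inl l ↔ g y = Sum.inl l) :
    place K hK f ≈ place K hK g := by
  have hr : ∀ y ∈ K.support, ∀ n, f y = Sum.inr n → ∃ m, g y = Sum.inr m := by
    intro y hy n hn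
    rcases hgy : g y with l | m
    · rw [← h y hy, hn] at hgy
      cases hgy
    · exact ⟨m, rfl⟩
  let num : Λ ⊕ ℕ → ℕ := Sum.elim (fun _ => 0) id
  obtain ⟨σ, hσ⟩ := exists_perm (s := {y | y ∈ K.support ∧ ∃ n, f y = Sum.inr n})
    ((support_finite hK).subset fun y hy => hy.1) (num ∘ f) (num ∘ g)
    (by
      rintro x ⟨hx, n, hn⟩ y ⟨hy, m, hm⟩ hxy
      apply hf hx hy
      simp only [Function.comp, hn, hm, num] at hxy
      rw [hn, hm]
      exact congrArg _ hxy)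
    (by
      rintro x ⟨hx, n, hn⟩ y ⟨hy, m, hm⟩ hxy
      obtain ⟨n', hn'⟩ := hr _ hx _ hn
      obtain ⟨m', hm'⟩ := hr _ hy _ hm
      apply hg hx hy
      simp only [Function.comp, hn', hm', num] at hxy
      rw [hn', hm']
      exact congrArg _ hxy)
  let τ : Λ ⊕ ℕ ≃ Λ ⊕ ℕ := Equiv.sumCongr (Equiv.refl Λ) σ
  have hτ : ∀ y ∈ K.support, τ (f y) = g y := by
    intro y hy
    rcases hfy : f y with l | n
    · simp [τ, (h y hy l).1 hfy]
    · obtain ⟨m, hm⟩ := hr _ hy _ hfy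
      have := hσ y ⟨hy, n, hfy⟩
      simp only [Function.comp, hfy, hm, num] at this
      rw [hm]
      exact congrArg Sum.inr this
  have key : K.map g = (K.map f).map τ := by
    rw [SimpleGraph.map_map]
    ext a b
    simp only [SimpleGraph.map_adj', Function.comp]
    refine and_congr_right fun _ => ⟨?_, ?_⟩
    · rintro ⟨u, v, huv, rfl, rfl⟩
      exact ⟨u, v, huv, hτ u ⟨v, huv⟩, hτ v ⟨u, huv.symm⟩⟩
    · rintro ⟨u, v, huv, rfl, rfl⟩
      exact ⟨u, v, huv, (hτ u ⟨v, huv⟩).symm, (hτ v ⟨u, huv.symm⟩).symm⟩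
  refine ⟨⟨τ, ?_⟩, fun l => rfl⟩
  intro a b
  simp only [place]
  rw [key]
  exact SimpleGraph.map_adj_apply (f := τ.toEmbedding)

theorem isom_of_graph_eq {Λ : Type} {G H : LGraph Λ} (h : G.graph = H.graph) : G ≈ H := by
  cases G
  cases H
  cases h
  exact (isom_equivalence Λ).refl _

/-- A union of two unlabeled graphs on disjoint vertex sets is their product. -/
theorem isom_mul_of_disjoint (G H K : LGraph Empty) (hK : K.graph = G.graph ⊔ H.graph)
    (hd : Disjoint G.graph.support H.graph.support) : K ≈ mul G H := by
  let L := glue G.graph H.graph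
  have hL := glue_edges_finite G.finite_edges H.finite_edges
  -- The folding map is far from injective, but it is injective on the support of `L` because the
  -- two supports are disjoint.
  let f : Empty ⊕ (ℕ ⊕ ℕ) → Empty ⊕ ℕ := Sum.map id (Sum.elim id id)
  have hl : Function.Injective (Sum.map id Sum.inl : Empty ⊕ ℕ → Empty ⊕ (ℕ ⊕ ℕ)) :=
    sumMap_injective Sum.inl_injective
  have hr : Function.Injective (Sum.map id Sum.inr : Empty ⊕ ℕ → Empty ⊕ (ℕ ⊕ ℕ)) :=
    sumMap_injective Sum.inr_injective
  have hsupp : ∀ y ∈ L.support, (∃ n, y = Sum.inr (Sum.inl n) ∧ Sum.inr n ∈ G.graph.support) ∨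
      (∃ n, y = Sum.inr (Sum.inr n) ∧ Sum.inr n ∈ H.graph.support) := by
    rintro y ⟨z, hyz⟩
    rcases hyz with ⟨-, a, b, hab, rfl, rfl⟩ | ⟨-, a, b, hab, rfl, rfl⟩
    · rcases a with a | a
      · exact a.elim
      · exact Or.inl ⟨a, rfl, b, hab⟩
    · rcases a with a | a
      · exact a.elim
      · exact Or.inr ⟨a, rfl, b, hab⟩
  have h1 : K ≈ place L hL f := by
    apply isom_of_graph_eq
    simp only [place, L, glue, map_sup_graph, SimpleGraph.map_map, f, hK]
    have e1 : (Sum.map id (Sum.elim id id) ∘ Sum.map id Sum.inl : Empty ⊕ ℕ → Empty ⊕ ℕ) = id := by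
      ext x; rcases x with x | x <;> simp
    have e2 : (Sum.map id (Sum.elim id id) ∘ Sum.map id Sum.inr : Empty ⊕ ℕ → Empty ⊕ ℕ) = id := by
      ext x; rcases x with x | x <;> simp
    rw [e1, e2, SimpleGraph.map_id, SimpleGraph.map_id]
  refine (isom_equivalence Empty).trans h1 ?_
  refine place_isom L hL f (Sum.map id Equiv.natSumNatEquivNat) ?_
    (sumMap_injective (Equiv.injective _)).injOn fun y _ l => l.elim
  intro x hx y hy hxy
  rcases hsupp x hx with ⟨n, rfl, hn⟩ | ⟨n, rfl, hn⟩ <;>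
    rcases hsupp y hy with ⟨m, rfl, hm⟩ | ⟨m, rfl, hm⟩ <;>
    simp only [f, Sum.map_inr, Sum.elim_inl, Sum.elim_inr, id, Sum.inr.injEq] at hxy <;> subst hxy
  · rfl
  · exact (hd.ne_of_mem hn hm rfl).elim
  · exact (hd.ne_of_mem hm hn rfl).elim
  · rfl

/-! ### Connected components of disjoint unions -/

section Components

open SimpleGraph

theorem mem_nontrivialComponents {Λ : Type} {G : LGraph Λ} {c : G.graph.ConnectedComponent} :
    c ∈ G.nontrivialComponents ↔ ∃ u ∈ G.graph.support, G.graph.connectedComponentMk u = c := by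
  simp [nontrivialComponents]

/-- A walk that starts in the support of `G` can never take an edge of `H`. -/
theorem reachable_of_mem_support_left {V : Type} {G H : SimpleGraph V}
    (hd : Disjoint G.support H.support) {u v : V} (hu : u ∈ G.support)
    (h : (G ⊔ H).Reachable u v) : G.Reachable u v ∧ v ∈ G.support := by
  obtain ⟨p⟩ := h
  induction p with
  | nil => exact ⟨Reachable.refl _, hu⟩
  | cons h p ih =>
    rcases h with h | h
    · obtain ⟨h1, h2⟩ := ih ⟨_, h.symm⟩
      exact ⟨h.reachable.trans h1, h2⟩
    · exact (hd.ne_of_mem hu ⟨_, h⟩ rfl).elim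

/-- Injectivity holds only on nontrivial components: vertices isolated in `G` may be joined by edges
of `H`. -/
theorem nontrivialComponents_sup_left {Λ : Type} {G H K : LGraph Λ}
    (hK : K.graph = G.graph ⊔ H.graph)
    (hd : Disjoint G.graph.support H.graph.support) :
    ∃ f : G.graph.ConnectedComponent → K.graph.ConnectedComponent,
      Set.InjOn f G.nontrivialComponents ∧
      (∀ c ∈ G.nontrivialComponents, (K.componentGraph (f c)).graph = (G.componentGraph c).graph) ∧
      ∀ u, f (G.graph.connectedComponentMk u) = K.graph.connectedComponentMk u := by
  have hle : G.graph ≤ K.graph := hK ▸ le_sup_left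
  refine ⟨ConnectedComponent.map (Hom.ofLE hle), ?_, ?_, fun u => rfl⟩
  · intro c hc c' hc' h
    obtain ⟨u, hu, rfl⟩ := mem_nontrivialComponents.1 hc
    obtain ⟨v, hv, rfl⟩ := mem_nontrivialComponents.1 hc'
    have h' : K.graph.Reachable u v := ConnectedComponent.exact h
    rw [hK] at h'
    exact ConnectedComponent.sound (reachable_of_mem_support_left hd hu h').1
  · intro c hc
    obtain ⟨u, hu, rfl⟩ := mem_nontrivialComponents.1 hc
    ext a b
    simp only [componentGraph, ConnectedComponent.map_mk, Hom.coe_ofLE, id,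
      ConnectedComponent.eq]
    constructor
    · rintro ⟨hab, h⟩
      have h' := h.symm
      rw [hK] at h'
      obtain ⟨h1, h2⟩ := reachable_of_mem_support_left hd hu h'
      rw [hK] at hab
      rcases hab with hab | hab
      · exact ⟨hab, h1.symm⟩
      · exact (hd.ne_of_mem h2 ⟨_, hab⟩ rfl).elim
    · rintro ⟨hab, h⟩
      exact ⟨hle hab, h.mono hle⟩

theorem components_eq_add {Λ : Type} {G H K : LGraph Λ} (hK : K.graph = G.graph ⊔ H.graph)
    (hd : Disjoint G.graph.support H.graph.support) :
    K.components = G.components + H.components := by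
  classical
  obtain ⟨f, hf, hfc, hfm⟩ := nontrivialComponents_sup_left hK hd
  obtain ⟨g, hg, hgc, hgm⟩ := nontrivialComponents_sup_left (hK.trans (sup_comm _ _)) hd.symm
  have himg : K.nontrivialComponents =
      G.nontrivialComponents.image f ∪ H.nontrivialComponents.image g := by
    ext c
    simp only [mem_nontrivialComponents, Finset.mem_union, Finset.mem_image]
    constructor
    · rintro ⟨u, ⟨v, huv⟩, rfl⟩
      rw [hK] at huv
      rcases huv with huv | huv
      · exact Or.inl ⟨_, ⟨u, ⟨v, huv⟩, rfl⟩, hfm u⟩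
      · exact Or.inr ⟨_, ⟨u, ⟨v, huv⟩, rfl⟩, hgm u⟩
    · rintro (⟨_, ⟨u, ⟨v, huv⟩, rfl⟩, rfl⟩ | ⟨_, ⟨u, ⟨v, huv⟩, rfl⟩, rfl⟩)
      · exact ⟨u, ⟨v, hK ▸ Or.inl huv⟩, (hfm u).symm⟩
      · exact ⟨u, ⟨v, hK ▸ Or.inr huv⟩, (hgm u).symm⟩
  have hdisj : Disjoint (G.nontrivialComponents.image f) (H.nontrivialComponents.image g) := by
    rw [Finset.disjoint_left]
    intro c hc hc'
    obtain ⟨c1, h1, rfl⟩ := Finset.mem_image.1 hc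
    obtain ⟨c2, h2, h12⟩ := Finset.mem_image.1 hc'
    obtain ⟨u, hu, rfl⟩ := mem_nontrivialComponents.1 h1
    obtain ⟨v, hv, rfl⟩ := mem_nontrivialComponents.1 h2
    rw [hfm, hgm] at h12
    have h' : K.graph.Reachable v u := ConnectedComponent.exact h12
    rw [hK] at h'
    exact hd.ne_of_mem (reachable_of_mem_support_left hd hu h'.symm).2 hv rfl
  rw [components, himg, ← Finset.disjUnion_eq_union _ _ hdisj, Finset.disjUnion_val,
    Multiset.map_add, Finset.image_val_of_injOn hf, Finset.image_val_of_injOn hg,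
    Multiset.map_map, Multiset.map_map]
  refine congr_arg₂ _ (Multiset.map_congr rfl fun c hc => Quotient.sound ?_)
    (Multiset.map_congr rfl fun c hc => Quotient.sound ?_)
  · exact isom_of_graph_eq (hfc c hc)
  · exact isom_of_graph_eq (hgc c hc)

theorem conn_componentGraph {Λ : Type} (G : LGraph Λ) {c : G.graph.ConnectedComponent}
    (hc : c ∈ G.nontrivialComponents) : (G.componentGraph c).Conn := by
  obtain ⟨u, ⟨v, huv⟩, rfl⟩ := mem_nontrivialComponents.1 hc
  have key : ∀ {a b : Λ ⊕ ℕ} (p : G.graph.Walk a b), G.graph.connectedComponentMk a =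
      G.graph.connectedComponentMk u →
      (G.componentGraph (G.graph.connectedComponentMk u)).graph.Reachable a b := by
    intro a b p
    induction p with
    | nil => exact fun _ => Reachable.refl _
    | cons h p ih =>
      intro ha
      exact (Adj.reachable (G := (G.componentGraph _).graph) ⟨h, ha⟩).trans
        (ih ((ConnectedComponent.connectedComponentMk_eq_of_adj h.symm).trans ha))
  refine ⟨⟨u, v, huv, rfl⟩, ?_⟩
  rintro a ⟨a', haa, ha⟩ b ⟨b', hbb, hb⟩
  obtain ⟨p⟩ := ConnectedComponent.exact (ha.trans hb.symm)
  exact key p ha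

end Components

end LGraph

/-! ### Factorization of a graph into its connected components -/

namespace PLGraph

/-- The isomorphism class of a concrete graph. -/
def mk {Λ : Type} (G : LGraph Λ) : PLGraph Λ := Quotient.mk _ G

theorem sound {Λ : Type} {G H : LGraph Λ} (h : G ≈ H) : mk G = mk H := Quotient.sound h

theorem exact {Λ : Type} {G H : LGraph Λ} (h : mk G = mk H) : G ≈ H := Quotient.exact h

theorem exists_mk {Λ : Type} (H : PLGraph Λ) : ∃ G, mk G = H := Quotient.exists_rep H

theorem mk_mul_mk {Λ : Type} (G H : LGraph Λ) : mk G * mk H = mk (LGraph.mul G H) := rfl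

theorem one_def (Λ : Type) : (1 : PLGraph Λ) = mk (LGraph.one Λ) := rfl

theorem components_mk {Λ : Type} (G : LGraph Λ) :
    (mk G).components = G.nontrivialComponents.val.map fun c => mk (G.componentGraph c) := rfl

theorem components_mul (G H : PLGraph Empty) :
    (G * H).components = G.components + H.components := by
  obtain ⟨G, rfl⟩ := exists_mk G
  obtain ⟨H, rfl⟩ := exists_mk H
  rw [mk_mul_mk]
  let f : ℕ → Empty ⊕ ℕ := fun n => Sum.inr (Equiv.natSumNatEquivNat (Sum.inl n))
  let g : ℕ → Empty ⊕ ℕ := fun n => Sum.inr (Equiv.natSumNatEquivNat (Sum.inr n))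
  have hf : Function.Injective f :=
    Sum.inr_injective.comp ((Equiv.injective _).comp Sum.inl_injective)
  have hg : Function.Injective g :=
    Sum.inr_injective.comp ((Equiv.injective _).comp Sum.inr_injective)
  -- The product is literally the union of these two copies, whose supports are disjoint.
  let G' := LGraph.place G.graph G.finite_edges (Sum.elim Empty.elim f : Empty ⊕ ℕ → Empty ⊕ ℕ)
  let H' := LGraph.place H.graph H.finite_edges (Sum.elim Empty.elim g : Empty ⊕ ℕ → Empty ⊕ ℕ)
  have inj : ∀ {f : ℕ → Empty ⊕ ℕ}, Function.Injective f →
      Function.Injective (Sum.elim Empty.elim f : Empty ⊕ ℕ → Empty ⊕ ℕ) := by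
    rintro f hf (a | a) (b | b) hab
    · exact a.elim
    · exact a.elim
    · exact b.elim
    · exact congrArg _ (hf hab)
  have key : ∀ (G : LGraph Empty) {f : ℕ → Empty ⊕ ℕ}, Function.Injective f →
      G ≈ LGraph.place G.graph G.finite_edges (Sum.elim Empty.elim f) := by
    intro G f hf
    exact LGraph.isom_of_map G.graph G.finite_edges id _ Function.injective_id
      (inj hf) (fun _ l => l.elim) _ _ (by simp) rfl
  have h : (LGraph.mul G H).components = G'.components + H'.components := by
    apply LGraph.components_eq_add
    · simp only [LGraph.mul, LGraph.glue, LGraph.map_sup_graph, SimpleGraph.map_map,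
        Sum.map_comp_map, G', H', LGraph.place]
      congr 2 <;> funext x <;> rcases x with x | x <;> first | exact x.elim | rfl
    · rw [Set.disjoint_left]
      rintro x ⟨y, -, a, b, -, rfl, -⟩ ⟨y', -, a', b', -, h, -⟩
      rcases a with a | a
      · exact a.elim
      rcases a' with a' | a'
      · exact a'.elim
      have h2 := Equiv.natSumNatEquivNat.injective (Sum.inr_injective h)
      cases h2
  show (LGraph.mul G H).components = G.components + H.components
  rw [h, ← LGraph.components_congr _ _ (key G hf), ← LGraph.components_congr _ _ (key H hg)]

theorem components_one : (1 : PLGraph Empty).components = 0 := by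
  show (LGraph.one Empty).components = 0
  rw [LGraph.components, Multiset.map_eq_zero, Finset.val_eq_zero,
    Finset.eq_empty_iff_forall_notMem]
  intro c hc
  obtain ⟨u, ⟨v, huv⟩, -⟩ := LGraph.mem_nontrivialComponents.1 hc
  exact huv

/-- A graph is the product of its connected components. -/
theorem prod_components (H : PLGraph Empty) : H.components.prod = H := by
  classical
  obtain ⟨G, rfl⟩ := exists_mk H
  -- The union of the components in `s`; adding components one at a time gives an induction through
  -- disjoint unions.
  let restr : Finset G.graph.ConnectedComponent → LGraph Empty := fun s =>
    { graph :=
        { Adj := fun u v => G.graph.Adj u v ∧ G.graph.connectedComponentMk u ∈ s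
          symm := ⟨fun _ _ h => ⟨h.1.symm,
            (SimpleGraph.ConnectedComponent.connectedComponentMk_eq_of_adj h.1.symm) ▸ h.2⟩⟩
          loopless := ⟨fun _ h => h.1.ne rfl⟩ }
      finite_edges := G.finite_edges.subset (SimpleGraph.edgeSet_mono fun _ _ h => h.1) }
  have key : ∀ s, (∏ c ∈ s, mk (G.componentGraph c)) =
      mk (restr s) := by
    intro s
    induction s using Finset.induction_on with
    | empty =>
      rw [Finset.prod_empty, one_def]
      refine sound (LGraph.isom_of_graph_eq ?_)
      ext a b
      simp [restr, LGraph.one]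
    | insert c s hc ih =>
      rw [Finset.prod_insert hc, ih, mk_mul_mk]
      refine (sound (LGraph.isom_mul_of_disjoint _ _ _ ?_ ?_)).symm
      · ext a b
        simp only [restr, LGraph.componentGraph, SimpleGraph.sup_adj, Finset.mem_insert]
        tauto
      · rw [Set.disjoint_left]
        rintro x ⟨y, -, h1⟩ ⟨z, -, h2⟩
        exact hc (h1 ▸ h2)
  have hG : mk G = mk (restr G.nontrivialComponents) := by
    refine sound (LGraph.isom_of_graph_eq ?_)
    ext a b
    exact ⟨fun h => ⟨h, LGraph.mem_nontrivialComponents.2 ⟨a, ⟨b, h⟩, rfl⟩⟩, fun h => h.1⟩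
  rw [components_mk]
  exact (key _).trans hG.symm

theorem mem_components_iff {G : LGraph Empty} {C : PLGraph Empty} :
    C ∈ (mk G).components ↔
      ∃ c ∈ G.nontrivialComponents, mk (G.componentGraph c) = C := by
  rw [components_mk, Multiset.mem_map]
  rfl

end PLGraph

/-! ### Membership in `sosGraphs d` -/

namespace PLGraph

theorem unlabel_mk (G : LGraph ℕ) : (mk G).unlabel = mk G.unlabel := rfl

theorem numEdges_mk {Λ : Type} (G : LGraph Λ) : (mk G).numEdges = G.graph.edgeSet.ncard := rfl

theorem conn_of_mem_components {H C : PLGraph Empty} (hC : C ∈ H.components) : C.Conn := by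
  obtain ⟨G, rfl⟩ := exists_mk H
  obtain ⟨c, hc, rfl⟩ := mem_components_iff.1 hC
  exact LGraph.conn_componentGraph G hc

/-- Keep only those edges of `A` and of `B` that end up in the given component. The labels stay in
place, so the reduced graphs still glue correctly. -/
theorem mem_sosGraphs_of_mem_components {d : ℕ} {A B : PLGraph ℕ} (hA : A.numEdges ≤ d)
    (hB : B.numEdges ≤ d) {C : PLGraph Empty} (hC : C ∈ (A * B).unlabel.components) :
    C ∈ sosGraphs d := by
  refine ⟨conn_of_mem_components hC, ?_⟩
  obtain ⟨G, rfl⟩ := exists_mk A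
  obtain ⟨H, rfl⟩ := exists_mk B
  rw [mk_mul_mk, unlabel_mk] at hC
  obtain ⟨c, hc, rfl⟩ := mem_components_iff.1 hC
  set K := ((G.mul H).unlabel.componentGraph c) with hK
  have hle : K.graph ≤ (G.mul H).unlabel.graph := fun _ _ h => h.1
  let e : ℕ ⊕ ℕ → Empty ⊕ ℕ := fun x => Sum.inr (Equiv.natSumNatEquivNat x)
  let f : ℕ ⊕ ℕ → Empty ⊕ ℕ :=
    e ∘ Sum.map id Equiv.natSumNatEquivNat ∘ Sum.map id Sum.inl
  let g : ℕ ⊕ ℕ → Empty ⊕ ℕ :=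
    e ∘ Sum.map id Equiv.natSumNatEquivNat ∘ Sum.map id Sum.inr
  have hgraph : (G.mul H).unlabel.graph = G.graph.map f ⊔ H.graph.map g := by
    simp only [LGraph.unlabel, LGraph.mul, LGraph.glue, LGraph.map_sup_graph, SimpleGraph.map_map]
    rfl
  have hsub : ∀ (G : LGraph ℕ) (f : ℕ ⊕ ℕ → Empty ⊕ ℕ),
      (G.graph ⊓ K.graph.comap f).edgeSet ⊆ G.graph.edgeSet :=
    fun G f => SimpleGraph.edgeSet_mono inf_le_left
  let A' : LGraph ℕ := ⟨G.graph ⊓ K.graph.comap f, G.finite_edges.subset (hsub G f)⟩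
  let B' : LGraph ℕ := ⟨H.graph ⊓ K.graph.comap g, H.finite_edges.subset (hsub H g)⟩
  refine ⟨mk A', mk B', (Set.ncard_le_ncard (hsub G f) G.finite_edges).trans hA,
    (Set.ncard_le_ncard (hsub H g) H.finite_edges).trans hB, ?_⟩
  rw [mk_mul_mk, unlabel_mk]
  refine sound (LGraph.isom_of_graph_eq ?_)
  have hgraph' : (A'.mul B').unlabel.graph = A'.graph.map f ⊔ B'.graph.map g := by
    simp only [LGraph.unlabel, LGraph.mul, LGraph.glue, LGraph.map_sup_graph, SimpleGraph.map_map]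
    rfl
  rw [hgraph']
  ext a b
  constructor
  · intro h
    have h2 := hle h
    rw [hgraph] at h2
    rcases h2 with ⟨hne, x, y, hxy, rfl, rfl⟩ | ⟨hne, x, y, hxy, rfl, rfl⟩
    · exact Or.inl ⟨hne, x, y, ⟨hxy, h⟩, rfl, rfl⟩
    · exact Or.inr ⟨hne, x, y, ⟨hxy, h⟩, rfl, rfl⟩
  · rintro (⟨hne, x, y, hxy, rfl, rfl⟩ | ⟨hne, x, y, hxy, rfl, rfl⟩)
    · exact hxy.2
    · exact hxy.2

theorem exists_unlabel (C : PLGraph Empty) :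
    ∃ A : PLGraph ℕ, A.unlabel = C ∧ A.numEdges = C.numEdges := by
  obtain ⟨G, rfl⟩ := exists_mk C
  let f : Empty ⊕ ℕ → ℕ ⊕ ℕ := Sum.elim Empty.elim Sum.inr
  have hf : Function.Injective f := by
    rintro (a | a) (b | b) hab
    · exact a.elim
    · exact a.elim
    · exact b.elim
    · exact congrArg _ (Sum.inr_injective hab)
  refine ⟨mk (LGraph.place G.graph G.finite_edges f), ?_, ?_⟩
  · rw [unlabel_mk]
    refine sound (LGraph.isom_of_map G.graph G.finite_edges
      ((fun x => Sum.inr (Equiv.natSumNatEquivNat x)) ∘ f) id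
      ((Sum.inr_injective.comp (Equiv.injective _)).comp hf) Function.injective_id
      (fun _ l => l.elim) _ _ ?_ (by simp))
    simp only [LGraph.unlabel, LGraph.place, SimpleGraph.map_map]
  · rw [numEdges_mk, numEdges_mk]
    show (G.graph.map f).edgeSet.ncard = _
    have := SimpleGraph.edgeSet_map ⟨f, hf⟩ G.graph
    simp only [Function.Embedding.coeFn_mk] at this
    rw [this, Set.ncard_map]

theorem numEdges_one {Λ : Type} : (1 : PLGraph Λ).numEdges = 0 := by
  rw [one_def, numEdges_mk]
  simp [LGraph.one]

theorem mem_sosGraphs {C : PLGraph Empty} (hC : C.Conn) {d : ℕ} (hd : C.numEdges ≤ d) :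
    C ∈ sosGraphs d := by
  obtain ⟨A, hA, hA'⟩ := exists_unlabel C
  exact ⟨hC, A, 1, hA' ▸ hd, by rw [numEdges_one]; exact Nat.zero_le _, by rw [mul_one, hA]⟩

end PLGraph

theorem sosGraphs_mono {d e : ℕ} (h : d ≤ e) : sosGraphs d ⊆ sosGraphs e := by
  rintro C ⟨hC, A, B, hA, hB, hAB⟩
  exact ⟨hC, A, B, hA.trans h, hB.trans h, hAB⟩

/-! ### Reflection positive parameters and points of the sos-profile -/

/-- The multiplicative graph parameter with prescribed values on the connected graphs. -/
noncomputable def extHom (v : PLGraph Empty → ℝ) : PLGraph Empty →* ℝ where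
  toFun H := (H.components.map v).prod
  map_one' := by rw [PLGraph.components_one, Multiset.map_zero, Multiset.prod_zero]
  map_mul' G H := by rw [PLGraph.components_mul, Multiset.map_add, Multiset.prod_add]

/-- The value of a graph combination under a multiplicative graph parameter. -/
noncomputable def paramEval (u : PLGraph Empty →* ℝ) : GraphComb →ₐ[ℝ] ℝ :=
  MonoidAlgebra.lift ℝ ℝ (PLGraph Empty) u

theorem paramEval_apply (u : PLGraph Empty →* ℝ) (a : GraphComb) :
    paramEval u a = a.coeff.sum fun H α => α * u H :=
  MonoidAlgebra.lift_apply u a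

theorem paramEval_extHom (v : PLGraph Empty → ℝ) (a : GraphComb) :
    paramEval (extHom v) a = a.eval v :=
  paramEval_apply _ _

theorem map_prod_components (u : PLGraph Empty →* ℝ) (H : PLGraph Empty) :
    (H.components.map u).prod = u H := by
  rw [← map_multiset_prod, PLGraph.prod_components]

/-- A multiplicative graph parameter that is nonnegative and whose moment form is positive
semidefinite on the partially labeled graphs with at most `d` edges. -/
structure IsReflPos (d : ℕ) (u : PLGraph Empty →* ℝ) : Prop where
  nonneg : ∀ H, 0 ≤ u H
  form_nonneg : ∀ {ι : Type} [Fintype ι] (c : ι → ℝ) (Φ : ι → PLGraph ℕ),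
    (∀ i, (Φ i).numEdges ≤ d) → 0 ≤ ∑ i, ∑ j, c i * c j * u (Φ i * Φ j).unlabel

theorem unlabel_sq_sum_single {ι : Type} [Fintype ι] (c : ι → ℝ) (Φ : ι → PLGraph ℕ) :
    LabeledComb.unlabel ((∑ i, MonoidAlgebra.single (Φ i) (c i)) ^ 2) =
      ∑ i, ∑ j, MonoidAlgebra.single ((Φ i * Φ j).unlabel) (c i * c j) := by
  have hadd : ∀ {κ : Type} [Fintype κ] (g : κ → LabeledComb),
      LabeledComb.unlabel (∑ k, g k) = ∑ k, LabeledComb.unlabel (g k) := by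
    intro κ _ g
    exact map_sum
      (AddMonoidHom.mk' LabeledComb.unlabel fun a b => MonoidAlgebra.mapDomain_add ..) g _
  rw [sq, Finset.sum_mul_sum, hadd]
  refine Finset.sum_congr rfl fun i _ => ?_
  rw [hadd]
  refine Finset.sum_congr rfl fun j _ => ?_
  rw [MonoidAlgebra.single_mul_single, LabeledComb.unlabel, MonoidAlgebra.mapDomain_single]

theorem paramEval_unlabel_sq (u : PLGraph Empty →* ℝ) {ι : Type} [Fintype ι] (c : ι → ℝ)
    (Φ : ι → PLGraph ℕ) :
    paramEval u (LabeledComb.unlabel ((∑ i, MonoidAlgebra.single (Φ i) (c i)) ^ 2)) =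
      ∑ i, ∑ j, c i * c j * u (Φ i * Φ j).unlabel := by
  rw [unlabel_sq_sum_single, map_sum]
  refine Finset.sum_congr rfl fun i _ => ?_
  rw [map_sum]
  refine Finset.sum_congr rfl fun j _ => ?_
  rw [paramEval, MonoidAlgebra.lift_single, smul_eq_mul]

theorem LabeledComb.eq_sum_single (f : LabeledComb) :
    f = ∑ A : f.coeff.support, MonoidAlgebra.single A.1 (f.coeff A.1) := by
  rw [Finset.sum_coe_sort f.coeff.support fun A => MonoidAlgebra.single A (f.coeff A)]
  exact (MonoidAlgebra.sum_coeff_single f).symm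

/-- Ensures that the values of a parameter outside `sosGraphs d` never enter the evaluation of a
`d`-sos combination. -/
theorem GraphComb.IsSos.components_mem {d : ℕ} {a : GraphComb} (ha : a.IsSos d)
    {H : PLGraph Empty} (hH : H ∈ a.coeff.support) {C : PLGraph Empty} (hC : C ∈ H.components) :
    C ∈ sosGraphs d := by
  classical
  obtain ⟨n, f, hf, rfl⟩ := ha
  by_contra hCd
  refine Finsupp.mem_support_iff.1 hH ?_
  rw [MonoidAlgebra.coeff_sum, Finsupp.finsetSum_apply]
  refine Finset.sum_eq_zero fun j _ => ?_
  rw [(f j).eq_sum_single, unlabel_sq_sum_single, MonoidAlgebra.coeff_sum,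
    Finsupp.finsetSum_apply]
  refine Finset.sum_eq_zero fun A _ => ?_
  rw [MonoidAlgebra.coeff_sum, Finsupp.finsetSum_apply]
  refine Finset.sum_eq_zero fun B _ => ?_
  rw [MonoidAlgebra.coeff_single, Finsupp.single_apply, if_neg]
  rintro rfl
  exact hCd (PLGraph.mem_sosGraphs_of_mem_components (hf j _ A.2) (hf j _ B.2) hC)

theorem IsReflPos.paramEval_nonneg {d : ℕ} {u : PLGraph Empty →* ℝ} (hu : IsReflPos d u)
    {a : GraphComb} (ha : a.IsSos d) : 0 ≤ paramEval u a := by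
  obtain ⟨n, f, hf, rfl⟩ := ha
  rw [map_sum]
  refine Finset.sum_nonneg fun j _ => ?_
  rw [(f j).eq_sum_single, paramEval_unlabel_sq]
  exact hu.form_nonneg _ _ fun A => hf j _ A.2

/-- Extension by 0 preserves nonnegativity, and the moment form is the value of a single `d`-sos
square. Passing to a parameter defined on all graphs makes it possible to mix without tracking which
graphs arise. -/
theorem isReflPos_of_mem_sosProfile {d : ℕ} {v : sosGraphs d → ℝ} (hv : v ∈ sosProfile d) :
    IsReflPos d (extHom (Function.extend Subtype.val v 0)) where
  nonneg H := by
    refine Multiset.prod_nonneg fun x hx => ?_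
    obtain ⟨C, -, rfl⟩ := Multiset.mem_map.1 hx
    by_cases hC : C ∈ sosGraphs d
    · have := Subtype.val_injective.extend_apply v 0 ⟨C, hC⟩
      rw [this]
      exact hv.1 _
    · rw [Function.extend_apply']
      · exact le_rfl
      · rintro ⟨⟨C', hC'⟩, rfl⟩
        exact hC hC'
  form_nonneg {ι} _ c Φ hΦ := by
    classical
    rw [← paramEval_unlabel_sq, paramEval_extHom]
    refine hv.2 _ ⟨1, fun _ => ∑ i, MonoidAlgebra.single (Φ i) (c i), ?_, by simp⟩
    intro _ H hH
    by_contra hHd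
    refine Finsupp.mem_support_iff.1 hH ?_
    rw [MonoidAlgebra.coeff_sum, Finsupp.finsetSum_apply]
    refine Finset.sum_eq_zero fun i _ => ?_
    rw [MonoidAlgebra.coeff_single, Finsupp.single_apply, if_neg]
    rintro rfl
    exact hHd (hΦ i)

theorem evalAt_restrict {d : ℕ} (u : PLGraph Empty →* ℝ) {a : GraphComb}
    (ha : ∀ H ∈ a.coeff.support, ∀ C ∈ H.components, C ∈ sosGraphs d) :
    a.evalAt (fun C : sosGraphs d => u C) = paramEval u a := by
  rw [paramEval_apply, GraphComb.evalAt, GraphComb.eval]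
  refine Finset.sum_congr rfl fun H hH => ?_
  beta_reduce
  rw [← map_prod_components u H]
  congr 2
  refine Multiset.map_congr rfl fun C hC => ?_
  exact Subtype.val_injective.extend_apply (fun C : sosGraphs d => u C) 0 ⟨C, ha H hH C hC⟩

theorem IsReflPos.restrict_mem {d : ℕ} {u : PLGraph Empty →* ℝ} (hu : IsReflPos d u) :
    (fun C : sosGraphs d => u C) ∈ sosProfile d := by
  refine ⟨fun C => hu.nonneg _, fun a ha => ?_⟩
  rw [evalAt_restrict u fun H hH C hC => ha.components_mem hH hC]
  exact hu.paramEval_nonneg ha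

theorem IsReflPos.mono {d e : ℕ} (h : d ≤ e) {u : PLGraph Empty →* ℝ} (hu : IsReflPos e u) :
    IsReflPos d u :=
  ⟨hu.nonneg, fun c Φ hΦ => hu.form_nonneg c Φ fun i => (hΦ i).trans h⟩

/-! ### Graphs on finite vertex types -/

namespace PLGraph

/-- The isomorphism class of a graph on a finite type, with the isolated vertices removed. -/
noncomputable def ofFinite {V : Type} [Finite V] (G : SimpleGraph V) : PLGraph Empty :=
  mk (LGraph.place G (Set.toFinite _) fun v => Sum.inr (Finite.equivFin V v : ℕ))

theorem ofFinite_eq_mk {V : Type} [Finite V] (G : SimpleGraph V) (hG : G.edgeSet.Finite)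
    (f : V → Empty ⊕ ℕ) (hf : Set.InjOn f G.support) :
    ofFinite G = mk (LGraph.place G hG f) :=
  sound (LGraph.place_isom G hG _ f (fun _ _ _ _ h =>
    (Finite.equivFin V).injective (Fin.val_injective (Sum.inr_injective h))) hf
    fun _ _ l => l.elim)

theorem ofFinite_map {V W : Type} [Finite V] [Finite W] (G : SimpleGraph V) {f : V → W}
    (hf : Function.Injective f) : ofFinite (G.map f) = ofFinite G := by
  rw [ofFinite_eq_mk G (Set.toFinite _)
    ((fun v => Sum.inr (Finite.equivFin W v : ℕ)) ∘ f : V → Empty ⊕ ℕ)]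
  · refine sound (LGraph.isom_of_graph_eq ?_)
    simp only [LGraph.place, SimpleGraph.map_map]
  · exact (Function.Injective.comp (fun x y h =>
      (Finite.equivFin W).injective (Fin.val_injective (Sum.inr_injective h))) hf).injOn

theorem sum_eq_map_sup_map {V W : Type} (G : SimpleGraph V) (H : SimpleGraph W) :
    G ⊕g H = G.map Sum.inl ⊔ H.map Sum.inr := by
  ext a b
  rcases a with a | a <;> rcases b with b | b <;> simp [SimpleGraph.map_adj'] <;>
    exact fun h => h.ne

theorem ofFinite_sum {V W : Type} [Finite V] [Finite W] (G : SimpleGraph V) (H : SimpleGraph W) :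
    ofFinite (G ⊕g H) = ofFinite G * ofFinite H := by
  rw [ofFinite_eq_mk (G ⊕g H) (Set.toFinite _)
    (Sum.elim (fun v => Sum.inr (Equiv.natSumNatEquivNat (Sum.inl (Finite.equivFin V v : ℕ))))
      (fun v => Sum.inr (Equiv.natSumNatEquivNat (Sum.inr (Finite.equivFin W v : ℕ))))),
    ofFinite, ofFinite, mk_mul_mk]
  · refine sound (LGraph.isom_of_graph_eq ?_)
    simp only [LGraph.place, LGraph.mul, LGraph.glue, LGraph.map_sup_graph, SimpleGraph.map_map,
      sum_eq_map_sup_map]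
    rfl
  · rintro (a | a) - (b | b) - hab
    · have := Equiv.natSumNatEquivNat.injective (Sum.inr_injective hab)
      exact congrArg _ ((Finite.equivFin V).injective (Fin.val_injective (Sum.inl_injective this)))
    · have := Equiv.natSumNatEquivNat.injective (Sum.inr_injective hab)
      cases this
    · have := Equiv.natSumNatEquivNat.injective (Sum.inr_injective hab)
      cases this
    · have := Equiv.natSumNatEquivNat.injective (Sum.inr_injective hab)
      exact congrArg _ ((Finite.equivFin W).injective (Fin.val_injective (Sum.inr_injective this)))

theorem ofFinite_bot {V : Type} [Finite V] : ofFinite (⊥ : SimpleGraph V) = 1 := by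
  refine sound (LGraph.isom_of_graph_eq ?_)
  ext a b
  simp [LGraph.place, LGraph.one, SimpleGraph.map_adj']

theorem ofFinite_iso {V W : Type} [Finite V] [Finite W] {G : SimpleGraph V} {H : SimpleGraph W}
    (φ : G ≃g H) : ofFinite G = ofFinite H := by
  rw [← ofFinite_map G φ.injective]
  congr 1
  ext a b
  rw [SimpleGraph.map_adj']
  constructor
  · rintro ⟨-, u, v, huv, rfl, rfl⟩
    exact φ.map_adj_iff.2 huv
  · intro h
    exact ⟨h.ne, φ.symm a, φ.symm b, φ.symm.map_adj_iff.2 h, by simp, by simp⟩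

theorem induce_support_full {V : Type} (G : SimpleGraph V) (v : G.support) :
    v ∈ (G.induce G.support).support := by
  obtain ⟨v, w, hvw⟩ := v
  exact ⟨⟨w, v, hvw.symm⟩, hvw⟩

theorem map_induce_support {V : Type} (G : SimpleGraph V) :
    (G.induce G.support).map (Subtype.val : G.support → V) = G := by
  ext a b
  rw [SimpleGraph.map_adj']
  constructor
  · rintro ⟨-, u, v, huv, rfl, rfl⟩
    exact huv
  · intro h
    exact ⟨h.ne, ⟨a, b, h⟩, ⟨b, a, h.symm⟩, h, rfl, rfl⟩

/-- Every unlabeled graph lives on a type `Fin n` without isolated vertices. -/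
theorem exists_ofFinite (H : PLGraph Empty) :
    ∃ (n : ℕ) (G : SimpleGraph (Fin n)), (∀ v, v ∈ G.support) ∧ ofFinite G = H := by
  obtain ⟨G, rfl⟩ := exists_mk H
  have : Finite G.graph.support := LGraph.support_finite G.finite_edges
  let K := G.graph.induce G.graph.support
  let e := Finite.equivFin G.graph.support
  refine ⟨_, K.map e, fun v => ?_, ?_⟩
  · obtain ⟨w, hw⟩ := induce_support_full G.graph (e.symm v)
    refine ⟨e w, ?_⟩
    show (K.map e).Adj v (e w)
    rw [← e.apply_symm_apply v]
    exact (SimpleGraph.map_adj_apply (G := K) (f := e.toEmbedding)).2 hw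
  · rw [ofFinite_map K e.injective, ofFinite_eq_mk K (Set.toFinite _) Subtype.val
      Subtype.val_injective.injOn]
    exact sound (LGraph.isom_of_graph_eq (map_induce_support G.graph))

/-- Every vertex lies on an edge, so an isomorphism of the placed graphs carries the image of `V`
onto the image of `W`. -/
theorem exists_iso_of_ofFinite_eq {V W : Type} [Finite V] [Finite W] {G : SimpleGraph V}
    {H : SimpleGraph W} (hG : ∀ v, v ∈ G.support) (hH : ∀ w, w ∈ H.support)
    (h : ofFinite G = ofFinite H) : Nonempty (G ≃g H) := by
  obtain ⟨φ, -⟩ := exact h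
  let f : V ↪ Empty ⊕ ℕ := ⟨fun v => Sum.inr (Finite.equivFin V v : ℕ), fun x y h =>
    (Finite.equivFin V).injective (Fin.val_injective (Sum.inr_injective h))⟩
  let g : W ↪ Empty ⊕ ℕ := ⟨fun v => Sum.inr (Finite.equivFin W v : ℕ), fun x y h =>
    (Finite.equivFin W).injective (Fin.val_injective (Sum.inr_injective h))⟩
  change G.map f ≃g H.map g at φ
  have h1 : ∀ v, ∃ w, g w = φ (f v) := by
    intro v
    obtain ⟨v', hv⟩ := hG v
    obtain ⟨-, w, w', -, hw, -⟩ := φ.map_adj_iff.2 (SimpleGraph.map_adj_apply.2 hv)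
    exact ⟨w, hw⟩
  have h2 : ∀ w, ∃ v, f v = φ.symm (g w) := by
    intro v
    obtain ⟨v', hv⟩ := hH v
    obtain ⟨-, w, w', -, hw, -⟩ := φ.symm.map_adj_iff.2 (SimpleGraph.map_adj_apply.2 hv)
    exact ⟨w, hw⟩
  choose s hs using h1
  choose t ht using h2
  refine ⟨⟨⟨s, t, fun v => ?_, fun w => ?_⟩, ?_⟩⟩
  · apply f.injective
    rw [ht, hs]
    simp
  · apply g.injective
    rw [hs, ht]
    simp
  · intro a b
    show H.Adj (s a) (s b) ↔ _
    rw [← SimpleGraph.map_adj_apply (f := g), hs, hs, φ.map_adj_iff, SimpleGraph.map_adj_apply]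

/-- The partially labeled graph on the labels `0, …, n - 1` and `n` unlabeled vertices. -/
def ofLabeled {n : ℕ} (G : SimpleGraph (Fin n ⊕ Fin n)) : PLGraph ℕ :=
  mk (LGraph.place G (Set.toFinite _) (Sum.map Fin.val Fin.val))

theorem unlabel_ofLabeled_mul {n : ℕ} (G H : SimpleGraph (Fin n ⊕ Fin n)) :
    (ofLabeled G * ofLabeled H).unlabel = ofFinite (LGraph.glue G H) := by
  let f : Fin n ⊕ (Fin n ⊕ Fin n) → Empty ⊕ ℕ := fun x => Sum.inr (Equiv.natSumNatEquivNat
    (Sum.map Fin.val (fun y => Equiv.natSumNatEquivNat (Sum.map Fin.val Fin.val y)) x))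
  have hf : Function.Injective f :=
    Sum.inr_injective.comp ((Equiv.injective _).comp (Sum.map_injective.2 ⟨Fin.val_injective,
      (Equiv.injective _).comp (Sum.map_injective.2 ⟨Fin.val_injective, Fin.val_injective⟩)⟩))
  rw [ofFinite_eq_mk (LGraph.glue G H) (Set.toFinite _) f hf.injOn, ofLabeled, ofLabeled,
    mk_mul_mk, unlabel_mk]
  refine sound (LGraph.isom_of_graph_eq ?_)
  simp only [LGraph.place, LGraph.unlabel, LGraph.mul, LGraph.glue, LGraph.map_sup_graph,
    SimpleGraph.map_map]
  congr 2 <;> funext x <;> rcases x with x | x <;> rfl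

theorem numEdges_ofLabeled_mono {n : ℕ} {G H : SimpleGraph (Fin n ⊕ Fin n)} (h : G ≤ H) :
    (ofLabeled G).numEdges ≤ (ofLabeled H).numEdges :=
  Set.ncard_le_ncard (SimpleGraph.edgeSet_mono (SimpleGraph.map_monotone _ h))
    (LGraph.place H (Set.toFinite _) _).finite_edges

/-- One `n` exceeding all the numbers in use puts the whole family on the same labels, so that the
colours of the labeled vertices can be fixed simultaneously. -/
theorem exists_ofLabeled {ι : Type} [Finite ι] (Φ : ι → PLGraph ℕ) :
    ∃ (n : ℕ) (G : ι → SimpleGraph (Fin n ⊕ Fin n)), ∀ i, ofLabeled (G i) = Φ i := by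
  choose H hH using fun i => exists_mk (Φ i)
  have hfin : (⋃ i, Sum.elim id id '' (H i).graph.support : Set ℕ).Finite :=
    Set.finite_iUnion fun i => (LGraph.support_finite (H i).finite_edges).image _
  obtain ⟨N, hN⟩ := hfin.bddAbove
  have hlt : ∀ i, ∀ x ∈ (H i).graph.support, Sum.elim id id x < N + 1 := fun i x hx =>
    Nat.lt_succ_of_le (hN (Set.mem_iUnion.2 ⟨i, x, hx, rfl⟩))
  refine ⟨N + 1, fun i => (H i).graph.comap (Sum.map Fin.val Fin.val), fun i => ?_⟩
  rw [← hH i]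
  refine sound (LGraph.isom_of_graph_eq ?_)
  have hex : ∀ x ∈ (H i).graph.support, ∃ y : Fin (N + 1) ⊕ Fin (N + 1),
      Sum.map Fin.val Fin.val y = x := by
    rintro (x | x) hx
    · exact ⟨Sum.inl ⟨x, hlt i _ hx⟩, rfl⟩
    · exact ⟨Sum.inr ⟨x, hlt i _ hx⟩, rfl⟩
  ext a b
  simp only [LGraph.place, SimpleGraph.map_adj']
  constructor
  · rintro ⟨-, u, v, huv, rfl, rfl⟩
    exact huv
  · intro h
    obtain ⟨u, rfl⟩ := hex a ⟨b, h⟩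
    obtain ⟨v, rfl⟩ := hex b ⟨_, h.symm⟩
    exact ⟨h.ne, u, v, h, rfl, rfl⟩

end PLGraph

open PLGraph

/-! ### Mixing a parameter by random colourings -/

/-- The edges of `G` both of whose ends are coloured `s` by `x`. -/
def colorClassGraph {V K : Type} (G : SimpleGraph V) (s : K) (x : V → K) : SimpleGraph V where
  Adj a b := G.Adj a b ∧ x a = s ∧ x b = s
  symm := ⟨fun _ _ h => ⟨h.1.symm, h.2.2, h.2.1⟩⟩
  loopless := ⟨fun _ h => h.1.ne rfl⟩

/-- The edges of `G` join only vertices whose colours are related by `R`. -/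
def ColoringRespects {V K : Type} (R : K → K → Prop) (G : SimpleGraph V) (x : V → K) : Prop :=
  ∀ a b, G.Adj a b → R (x a) (x b)

open Classical in
/-- The contribution of the colouring `x` to the value of `G`. -/
noncomputable def mixTerm {V K : Type} [Finite V] (R : K → K → Prop) (s : K)
    (u : PLGraph Empty →* ℝ) (G : SimpleGraph V) (x : V → K) : ℝ :=
  if ColoringRespects R G x then u (ofFinite (colorClassGraph G s x)) else 0

/-- The expectation of `mixTerm` when the vertices are coloured independently with weights `p`. -/
noncomputable def mixSum {V K : Type} [Fintype V] [DecidableEq V] [Fintype K]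
    (R : K → K → Prop) (s : K) (u : PLGraph Empty →* ℝ) (p : K → ℝ) (G : SimpleGraph V) : ℝ :=
  ∑ x : V → K, (∏ v, p (x v)) * mixTerm R s u G x

section Mix

variable {K : Type} (R : K → K → Prop) (s : K) (u : PLGraph Empty →* ℝ)

theorem mixTerm_iso {V W : Type} [Finite V] [Finite W] {G : SimpleGraph V} {H : SimpleGraph W}
    (φ : G ≃g H) (x : W → K) : mixTerm R s u G (x ∘ φ) = mixTerm R s u H x := by
  have h1 : ColoringRespects R G (x ∘ φ) ↔ ColoringRespects R H x := by
    constructor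
    · intro h a b hab
      have := h (φ.symm a) (φ.symm b) (φ.symm.map_adj_iff.2 hab)
      simpa using this
    · intro h a b hab
      exact h _ _ (φ.map_adj_iff.2 hab)
  have h2 : ofFinite (colorClassGraph G s (x ∘ φ)) = ofFinite (colorClassGraph H s x) :=
    ofFinite_iso ⟨φ.toEquiv, and_congr_left fun _ => φ.map_adj_iff⟩
  rw [mixTerm, mixTerm, h2]
  classical exact if_congr h1 rfl rfl

theorem mixTerm_sum {V W : Type} [Finite V] [Finite W] (G : SimpleGraph V) (H : SimpleGraph W)
    (x : V → K) (y : W → K) :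
    mixTerm R s u (G ⊕g H) (Sum.elim x y) = mixTerm R s u G x * mixTerm R s u H y := by
  have h1 : ColoringRespects R (G ⊕g H) (Sum.elim x y) ↔
      ColoringRespects R G x ∧ ColoringRespects R H y := by
    constructor
    · intro h
      exact ⟨fun a b hab => h (Sum.inl a) (Sum.inl b) hab,
        fun a b hab => h (Sum.inr a) (Sum.inr b) hab⟩
    · rintro ⟨h1, h2⟩ (a | a) (b | b) hab
      · exact h1 a b hab
      · simp at hab
      · simp at hab
      · exact h2 a b hab
  have h2 : colorClassGraph (G ⊕g H) s (Sum.elim x y) =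
      colorClassGraph G s x ⊕g colorClassGraph H s y := by
    ext a b
    rcases a with a | a <;> rcases b with b | b <;> simp [colorClassGraph]
  simp only [mixTerm, h1, h2, ofFinite_sum, map_mul]
  split_ifs <;> simp_all

theorem colorClassGraph_glue {L X Y : Type} (G : SimpleGraph (L ⊕ X)) (H : SimpleGraph (L ⊕ Y))
    (x : L → K) (y : X → K) (z : Y → K) :
    colorClassGraph (LGraph.glue G H) s (Sum.elim x (Sum.elim y z)) =
      LGraph.glue (colorClassGraph G s (Sum.elim x y)) (colorClassGraph H s (Sum.elim x z)) := by
  have e1 : ∀ a, Sum.elim x (Sum.elim y z) (Sum.map id Sum.inl a) = Sum.elim x y a := by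
    rintro (a | a) <;> rfl
  have e2 : ∀ a, Sum.elim x (Sum.elim y z) (Sum.map id Sum.inr a) = Sum.elim x z a := by
    rintro (a | a) <;> rfl
  ext a b
  constructor
  · rintro ⟨⟨hne, c, d, hcd, rfl, rfl⟩ | ⟨hne, c, d, hcd, rfl, rfl⟩, h1, h2⟩
    · rw [e1] at h1 h2
      exact Or.inl ⟨hne, c, d, ⟨hcd, h1, h2⟩, rfl, rfl⟩
    · rw [e2] at h1 h2
      exact Or.inr ⟨hne, c, d, ⟨hcd, h1, h2⟩, rfl, rfl⟩
  · rintro (⟨hne, c, d, ⟨hcd, h1, h2⟩, rfl, rfl⟩ | ⟨hne, c, d, ⟨hcd, h1, h2⟩, rfl, rfl⟩)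
    · rw [← e1] at h1 h2
      exact ⟨Or.inl ⟨hne, c, d, hcd, rfl, rfl⟩, h1, h2⟩
    · rw [← e2] at h1 h2
      exact ⟨Or.inr ⟨hne, c, d, hcd, rfl, rfl⟩, h1, h2⟩

theorem coloringRespects_glue {L X Y : Type} (G : SimpleGraph (L ⊕ X)) (H : SimpleGraph (L ⊕ Y))
    (x : L → K) (y : X → K) (z : Y → K) :
    ColoringRespects R (LGraph.glue G H) (Sum.elim x (Sum.elim y z)) ↔
      ColoringRespects R G (Sum.elim x y) ∧ ColoringRespects R H (Sum.elim x z) := by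
  have e1 : ∀ a, Sum.elim x (Sum.elim y z) (Sum.map id Sum.inl a) = Sum.elim x y a := by
    rintro (a | a) <;> rfl
  have e2 : ∀ a, Sum.elim x (Sum.elim y z) (Sum.map id Sum.inr a) = Sum.elim x z a := by
    rintro (a | a) <;> rfl
  constructor
  · intro h
    refine ⟨fun a b hab => ?_, fun a b hab => ?_⟩
    · rw [← e1, ← e1]
      exact h _ _ (Or.inl ⟨(LGraph.sumMap_injective Sum.inl_injective).ne hab.ne,
        a, b, hab, rfl, rfl⟩)
    · rw [← e2, ← e2]
      exact h _ _ (Or.inr ⟨(LGraph.sumMap_injective Sum.inr_injective).ne hab.ne,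
        a, b, hab, rfl, rfl⟩)
  · rintro ⟨h1, h2⟩ _ _ (⟨hne, c, d, hcd, rfl, rfl⟩ | ⟨hne, c, d, hcd, rfl, rfl⟩)
    · rw [e1, e1]
      exact h1 c d hcd
    · rw [e2, e2]
      exact h2 c d hcd

-- Every edge of a glued graph comes from one factor. Hence, given the colours of the labeled
-- vertices, the compatibility condition splits and the colour class is itself a gluing.
open Classical in
theorem mixTerm_glue {n : ℕ} (G H : SimpleGraph (Fin n ⊕ Fin n)) (x y z : Fin n → K) :
    mixTerm R s u (LGraph.glue G H) (Sum.elim x (Sum.elim y z)) =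
      (if ColoringRespects R G (Sum.elim x y) then 1 else 0) *
      (if ColoringRespects R H (Sum.elim x z) then 1 else 0) *
      u (ofLabeled (colorClassGraph G s (Sum.elim x y)) *
        ofLabeled (colorClassGraph H s (Sum.elim x z))).unlabel := by
  simp only [mixTerm, coloringRespects_glue, colorClassGraph_glue, unlabel_ofLabeled_mul]
  split_ifs <;> simp_all

variable [Fintype K] (p : K → ℝ)

theorem mixSum_iso {V W : Type} [Fintype V] [Fintype W] [DecidableEq V] [DecidableEq W]
    {G : SimpleGraph V} {H : SimpleGraph W}
    (φ : G ≃g H) : mixSum R s u p G = mixSum R s u p H := by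
  refine Fintype.sum_equiv (Equiv.arrowCongr φ.toEquiv (Equiv.refl K)) _ _ fun x => ?_
  have hx : (Equiv.arrowCongr φ.toEquiv (Equiv.refl K) x) ∘ φ = x := by
    funext v
    exact congrArg x (φ.symm_apply_apply v)
  rw [← mixTerm_iso R s u φ, hx]
  congr 1
  refine Fintype.prod_equiv φ.toEquiv _ _ fun v => ?_
  exact congrArg p (congrFun hx v).symm

theorem mixSum_sum {V W : Type} [Fintype V] [Fintype W] [DecidableEq V] [DecidableEq W]
    (G : SimpleGraph V) (H : SimpleGraph W) :
    mixSum R s u p (G ⊕g H) = mixSum R s u p G * mixSum R s u p H := by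
  rw [mixSum, mixSum, mixSum, Finset.sum_mul_sum, ← Fintype.sum_prod_type',
    ← Fintype.sum_equiv (Equiv.sumArrowEquivProdArrow V W K).symm _ _ fun _ => rfl]
  refine Finset.sum_congr rfl fun ⟨x, y⟩ _ => ?_
  have : (Equiv.sumArrowEquivProdArrow V W K).symm (x, y) = Sum.elim x y := rfl
  rw [this, mixTerm_sum, Fintype.prod_sum_type]
  simp only [Sum.elim_inl, Sum.elim_inr]
  ring

theorem sum_prod_weights (hp : ∑ k, p k = 1) (V : Type) [Fintype V] [DecidableEq V] :
    ∑ x : V → K, ∏ v, p (x v) = 1 := by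
  rw [← Fintype.prod_sum fun (_ : V) k => p k]
  simp [hp]

theorem mixSum_bot (hp : ∑ k, p k = 1) (V : Type) [Fintype V] [DecidableEq V] :
    mixSum R s u p (⊥ : SimpleGraph V) = 1 := by
  rw [← sum_prod_weights p hp V]
  refine Finset.sum_congr rfl fun x _ => ?_
  have h : colorClassGraph (⊥ : SimpleGraph V) s x = ⊥ := by
    ext a b
    simp [colorClassGraph]
  have h' : ColoringRespects R (⊥ : SimpleGraph V) x := fun a b hab => hab.elim
  rw [mixTerm, if_pos h', h, ofFinite_bot, map_one, mul_one]

/-- The vertices outside the range of `f` are isolated, and each contributes the factor `∑ k, p k =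
1`. -/
theorem mixSum_map (hp : ∑ k, p k = 1) {V W : Type} [Fintype V] [Fintype W]
    [DecidableEq V] [DecidableEq W] (G : SimpleGraph V) {f : V → W}
    (hf : Function.Injective f) : mixSum R s u p (G.map f) = mixSum R s u p G := by
  classical
  let e : V ⊕ ((Set.range f)ᶜ : Set W) ≃ W :=
    ((Equiv.ofInjective f hf).sumCongr (Equiv.refl _)).trans (Equiv.Set.sumCompl _)
  have he : ∀ v, e (Sum.inl v) = f v := fun v => rfl
  let φ : G ⊕g (⊥ : SimpleGraph ((Set.range f)ᶜ : Set W)) ≃g G.map f := ⟨e, by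
    intro a b
    constructor
    · rintro ⟨-, c, d, hcd, hc, hd⟩
      rw [← he, e.injective.eq_iff] at hc hd
      subst hc hd
      exact hcd
    · intro h
      rcases a with a | a <;> rcases b with b | b
      · exact ⟨e.injective.ne h.ne, a, b, h, rfl, rfl⟩
      · simp at h
      · simp at h
      · simp at h⟩
  rw [← mixSum_iso R s u p φ, mixSum_sum, mixSum_bot R s u p hp, mul_one]

/-- Makes `mixHom` independent of the chosen representative: both graphs reduce to their supports,
which are isomorphic. -/
theorem mixSum_eq_of_ofFinite_eq (hp : ∑ k, p k = 1) {V W : Type} [Fintype V] [Fintype W]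
    [DecidableEq V] [DecidableEq W] {G : SimpleGraph V} {H : SimpleGraph W}
    (h : ofFinite G = ofFinite H) : mixSum R s u p G = mixSum R s u p H := by
  classical
  have := Fintype.ofFinite G.support
  have := Fintype.ofFinite H.support
  have hG := mixSum_map R s u p hp (G.induce G.support) Subtype.val_injective
  have hH := mixSum_map R s u p hp (H.induce H.support) Subtype.val_injective
  have hG' := ofFinite_map (G.induce G.support) Subtype.val_injective
  have hH' := ofFinite_map (H.induce H.support) Subtype.val_injective
  rw [map_induce_support] at hG hH hG' hH'
  obtain ⟨φ⟩ := exists_iso_of_ofFinite_eq (induce_support_full G) (induce_support_full H)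
    (hG'.symm.trans (h.trans hH'))
  rw [hG, hH, mixSum_iso R s u p φ]

/-- The multiplicative graph parameter obtained from `u` by colouring the vertices independently
with weights `p`, requiring edges to respect `R`, and evaluating `u` on the colour class `s`. -/
noncomputable def mixHom (hp : ∑ k, p k = 1) : PLGraph Empty →* ℝ where
  toFun H := mixSum R s u p (exists_ofFinite H).choose_spec.choose
  map_one' := by
    rw [← mixSum_bot R s u p hp (Fin 0)]
    apply mixSum_eq_of_ofFinite_eq R s u p hp
    rw [(exists_ofFinite 1).choose_spec.choose_spec.2, ofFinite_bot]
  map_mul' G H := by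
    rw [← mixSum_sum]
    apply mixSum_eq_of_ofFinite_eq R s u p hp
    rw [ofFinite_sum, (exists_ofFinite _).choose_spec.choose_spec.2,
      (exists_ofFinite _).choose_spec.choose_spec.2, (exists_ofFinite _).choose_spec.choose_spec.2]

theorem mixHom_ofFinite (hp : ∑ k, p k = 1) {V : Type} [Fintype V] [DecidableEq V]
    (G : SimpleGraph V) : mixHom R s u p hp (ofFinite G) = mixSum R s u p G :=
  mixSum_eq_of_ofFinite_eq R s u p hp (exists_ofFinite _).choose_spec.choose_spec.2

theorem mixSum_glue {n : ℕ} (G H : SimpleGraph (Fin n ⊕ Fin n)) :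
    mixSum R s u p (LGraph.glue G H) = ∑ x : Fin n → K, (∏ v, p (x v)) *
      ∑ y : Fin n → K, ∑ z : Fin n → K, (∏ v, p (y v)) * (∏ v, p (z v)) *
        mixTerm R s u (LGraph.glue G H) (Sum.elim x (Sum.elim y z)) := by
  rw [mixSum, ← Fintype.sum_equiv (Equiv.sumArrowEquivProdArrow _ _ K).symm _ _ fun _ => rfl,
    Fintype.sum_prod_type]
  refine Finset.sum_congr rfl fun x _ => ?_
  rw [← Fintype.sum_equiv (Equiv.sumArrowEquivProdArrow _ _ K).symm _ _ fun _ => rfl,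
    Fintype.sum_prod_type, Finset.mul_sum]
  refine Finset.sum_congr rfl fun y _ => ?_
  rw [Finset.mul_sum]
  refine Finset.sum_congr rfl fun z _ => ?_
  have h : (Equiv.sumArrowEquivProdArrow (Fin n) (Fin n ⊕ Fin n) K).symm
      (x, (Equiv.sumArrowEquivProdArrow (Fin n) (Fin n) K).symm (y, z)) =
      Sum.elim x (Sum.elim y z) := rfl
  rw [h, Fintype.prod_sum_type, Fintype.prod_sum_type]
  simp only [Sum.elim_inl, Sum.elim_inr]
  ring

/-- The colours `x` of the labeled vertices are shared by both factors, while the colours `y` and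
`z` of the unlabeled ones are independent. For fixed `x` the sum is a moment form of `u` indexed by
pairs of a graph and a colouring of its unlabeled vertices. -/
theorem IsReflPos.mixHom {d : ℕ} {u : PLGraph Empty →* ℝ} (hu : IsReflPos d u)
    (hp : ∑ k, p k = 1) (hp0 : ∀ k, 0 ≤ p k) : IsReflPos d (mixHom R s u p hp) where
  nonneg H := by
    obtain ⟨n, G, -, rfl⟩ := exists_ofFinite H
    rw [mixHom_ofFinite]
    refine Finset.sum_nonneg fun x _ => mul_nonneg (Finset.prod_nonneg fun _ _ => hp0 _) ?_
    rw [mixTerm]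
    split_ifs
    · exact hu.nonneg _
    · exact le_rfl
  form_nonneg {ι} _ c Φ hΦ := by
    classical
    obtain ⟨n, G, hG⟩ := exists_ofLabeled Φ
    have hval : ∀ i j, _root_.mixHom R s u p hp (Φ i * Φ j).unlabel =
        ∑ x : Fin n → K, (∏ v, p (x v)) *
          ∑ y : Fin n → K, ∑ z : Fin n → K, (∏ v, p (y v)) * (∏ v, p (z v)) *
          mixTerm R s u (LGraph.glue (G i) (G j)) (Sum.elim x (Sum.elim y z)) := by
      intro i j
      rw [← hG, ← hG, unlabel_ofLabeled_mul, mixHom_ofFinite, mixSum_glue]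
    have key : ∑ i, ∑ j, c i * c j * _root_.mixHom R s u p hp (Φ i * Φ j).unlabel =
        ∑ x : Fin n → K, (∏ v, p (x v)) * ∑ iy : ι × (Fin n → K), ∑ jz : ι × (Fin n → K),
          (c iy.1 * (∏ v, p (iy.2 v)) *
            (if ColoringRespects R (G iy.1) (Sum.elim x iy.2) then 1 else 0)) *
          (c jz.1 * (∏ v, p (jz.2 v)) *
            (if ColoringRespects R (G jz.1) (Sum.elim x jz.2) then 1 else 0)) *
          u (ofLabeled (colorClassGraph (G iy.1) s (Sum.elim x iy.2)) *
            ofLabeled (colorClassGraph (G jz.1) s (Sum.elim x jz.2))).unlabel := by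
      have h1 : ∀ i j, c i * c j * _root_.mixHom R s u p hp (Φ i * Φ j).unlabel =
          ∑ x : Fin n → K, ∑ y : Fin n → K, ∑ z : Fin n → K, (∏ v, p (x v)) *
            (c i * c j * ((∏ v, p (y v)) * (∏ v, p (z v)) *
            mixTerm R s u (LGraph.glue (G i) (G j)) (Sum.elim x (Sum.elim y z)))) := by
        intro i j
        rw [hval, Finset.mul_sum]
        refine Finset.sum_congr rfl fun x _ => ?_
        simp only [Finset.mul_sum]
        exact Finset.sum_congr rfl fun y _ => Finset.sum_congr rfl fun z _ => by ring
      simp only [h1]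
      rw [Finset.sum_congr rfl fun i _ => Finset.sum_comm, Finset.sum_comm]
      refine Finset.sum_congr rfl fun x _ => ?_
      rw [Fintype.sum_prod_type, Finset.mul_sum]
      refine Finset.sum_congr rfl fun i _ => ?_
      rw [Finset.sum_comm, Finset.mul_sum]
      refine Finset.sum_congr rfl fun y _ => ?_
      rw [Fintype.sum_prod_type, Finset.mul_sum]
      refine Finset.sum_congr rfl fun j _ => ?_
      rw [Finset.mul_sum]
      refine Finset.sum_congr rfl fun z _ => ?_
      rw [mixTerm_glue]
      ring
    rw [key]
    refine Finset.sum_nonneg fun x _ => mul_nonneg (Finset.prod_nonneg fun _ _ => hp0 _) ?_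
    refine hu.form_nonneg (fun iy : ι × (Fin n → K) => c iy.1 * (∏ v, p (iy.2 v)) *
            (if ColoringRespects R (G iy.1) (Sum.elim x iy.2) then 1 else 0))
      (fun iy => ofLabeled (colorClassGraph (G iy.1) s (Sum.elim x iy.2))) fun iy => ?_
    -- Passing to a colour class only deletes edges, so the degree bound `d` is kept.
    refine le_trans ?_ ((congrArg numEdges (hG iy.1)).le.trans (hΦ iy.1))
    exact numEdges_ofLabeled_mono fun _ _ h => h.1

end Mix

theorem PLGraph.numEdges_ofFinite {V : Type} [Finite V] (G : SimpleGraph V) :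
    (ofFinite G).numEdges = G.edgeSet.ncard := by
  let f : V ↪ Empty ⊕ ℕ := ⟨fun v => Sum.inr (Finite.equivFin V v : ℕ), fun x y h =>
    (Finite.equivFin V).injective (Fin.val_injective (Sum.inr_injective h))⟩
  show (G.map f).edgeSet.ncard = _
  rw [SimpleGraph.edgeSet_map, Set.ncard_map]

/-- The image of `G` is a subgraph of `H` with at least as many edges, hence all of `H` up to
isolated vertices. -/
theorem PLGraph.ofFinite_eq_of_injective_hom {V W : Type} [Finite V] [Finite W]
    {G : SimpleGraph V} {H : SimpleGraph W} {y : V → W} (hy : Function.Injective y)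
    (hom : ∀ a b, G.Adj a b → H.Adj (y a) (y b)) (hcard : H.edgeSet.ncard ≤ G.edgeSet.ncard) :
    ofFinite G = ofFinite H := by
  have hle : G.map y ≤ H := by
    rintro _ _ ⟨-, a, b, hab, rfl, rfl⟩
    exact hom a b hab
  have h1 : (G.map y).edgeSet.ncard = G.edgeSet.ncard := by
    have := SimpleGraph.edgeSet_map ⟨y, hy⟩ G
    simp only [Function.Embedding.coeFn_mk] at this
    rw [this, Set.ncard_map]
  have h2 : G.map y = H := by
    rw [← SimpleGraph.edgeSet_inj]
    exact Set.eq_of_subset_of_ncard_le (SimpleGraph.edgeSet_mono hle) (h1 ▸ hcard) (Set.toFinite _)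
  rw [← ofFinite_map G hy, h2]

/-! ### The polynomial path from `u` to a homomorphism density -/

section Path

variable {V₀ : Type}

/-- The colour `none` carries the given parameter, the colours `some (some v)` form the
graph `H₀`, and no edge may meet the colour `some none`. -/
def pathRel (H₀ : SimpleGraph V₀) : Option (Option V₀) → Option (Option V₀) → Prop
  | none, none => True
  | some (some a), some (some b) => H₀.Adj a b
  | _, _ => False

variable [Fintype V₀]

/-- The weights of the colours at the point `θ`, as polynomials in `θ`. -/
noncomputable def pathPoly (q : V₀ → ℝ) : Option (Option V₀) → Polynomial ℝ
  | none => 1 - Polynomial.X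
  | some none => Polynomial.C (1 - ∑ v, q v) * Polynomial.X
  | some (some v) => Polynomial.C (q v) * Polynomial.X

/-- The weights of the colours at the point `θ`. -/
noncomputable def pathWeight (q : V₀ → ℝ) (θ : ℝ) (k : Option (Option V₀)) : ℝ :=
  (pathPoly q k).eval θ

theorem sum_pathWeight (q : V₀ → ℝ) (θ : ℝ) : ∑ k, pathWeight q θ k = 1 := by
  rw [Fintype.sum_option, Fintype.sum_option]
  simp only [pathWeight, pathPoly, Polynomial.eval_sub, Polynomial.eval_one, Polynomial.eval_X,
    Polynomial.eval_mul, Polynomial.eval_C]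
  rw [← Finset.sum_mul]
  ring

theorem pathWeight_nonneg {q : V₀ → ℝ} (hq : ∀ v, 0 ≤ q v) (hq1 : ∑ v, q v ≤ 1) {θ : ℝ}
    (h0 : 0 ≤ θ) (h1 : θ ≤ 1) (k : Option (Option V₀)) : 0 ≤ pathWeight q θ k := by
  rcases k with _ | _ | v
  · simpa [pathWeight, pathPoly] using h1
  · simpa only [pathWeight, pathPoly, Polynomial.eval_mul, Polynomial.eval_C, Polynomial.eval_X]
      using mul_nonneg (sub_nonneg.2 hq1) h0
  · simpa [pathWeight, pathPoly] using mul_nonneg (hq v) h0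

variable (H₀ : SimpleGraph V₀) (u : PLGraph Empty →* ℝ) (q : V₀ → ℝ)

/-- A path of multiplicative graph parameters from `u` to the homomorphism density of the
vertex-weighted graph `H₀`. -/
noncomputable def pathHom (θ : ℝ) : PLGraph Empty →* ℝ :=
  mixHom (pathRel H₀) none u (pathWeight q θ) (sum_pathWeight q θ)

/-- Only the constant colouring `none` has nonzero weight, and its colour class is the whole graph.
-/
theorem pathHom_zero : pathHom H₀ u q 0 = u := by
  ext H
  obtain ⟨n, G, -, rfl⟩ := exists_ofFinite H
  rw [pathHom, mixHom_ofFinite, mixSum, Finset.sum_eq_single fun _ => none]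
  · have h1 : ColoringRespects (pathRel H₀) G fun _ => none := fun _ _ _ => trivial
    have h2 : colorClassGraph G (none : Option (Option V₀)) (fun _ => none) = G := by
      ext a b
      simp [colorClassGraph]
    rw [mixTerm, if_pos h1, h2]
    simp [pathWeight, pathPoly]
  · intro x _ hx
    obtain ⟨v, hv⟩ := Function.ne_iff.1 hx
    rw [Finset.prod_eq_zero (Finset.mem_univ v), zero_mul]
    rcases h : x v with _ | _ | w
    · exact (hv h).elim
    · simp [pathWeight, pathPoly]
    · simp [pathWeight, pathPoly]
  · simp

-- The colour `none` now has weight 0, and the dead colour `some none` is excluded because every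
-- vertex lies on an edge. The surviving colourings are the homomorphisms to `H₀`, and their colour
-- class is empty.
open Classical in
theorem pathHom_one {V : Type} [Fintype V] {G : SimpleGraph V} (hG : ∀ v, v ∈ G.support) :
    pathHom H₀ u q 1 (ofFinite G) =
      ∑ y : V → V₀, if (∀ a b, G.Adj a b → H₀.Adj (y a) (y b)) then ∏ v, q (y v) else 0 := by
  rw [pathHom, mixHom_ofFinite, mixSum]
  symm
  refine Fintype.sum_of_injective (fun y v => some (some (y v))) ?_ _ _ ?_ ?_
  · intro y z hyz
    funext v
    exact Option.some_injective _ (Option.some_injective _ (congrFun hyz v))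
  · intro x hx
    by_contra hne
    have h1 : ∀ v, x v ≠ none := by
      intro v hv
      refine hne ?_
      rw [Finset.prod_eq_zero (Finset.mem_univ v), zero_mul]
      simp [hv, pathWeight, pathPoly]
    have h2 : ColoringRespects (pathRel H₀) G x := by
      by_contra h
      exact hne (by rw [mixTerm, if_neg h, mul_zero])
    have h3 : ∀ v, ∃ w, some (some w) = x v := by
      intro v
      obtain ⟨v', hv⟩ := hG v
      have := h2 v v' hv
      rcases h : x v with _ | _ | w
      · exact (h1 v h).elim
      · rw [h] at this
        exact this.elim
      · exact ⟨w, rfl⟩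
    choose y hy using h3
    exact hx ⟨y, funext hy⟩
  · intro y
    have h1 : colorClassGraph G (none : Option (Option V₀)) (fun v => some (some (y v))) = ⊥ := by
      ext a b
      simp [colorClassGraph]
    rw [mixTerm, h1, ofFinite_bot, map_one, mul_ite, mul_one, mul_zero]
    refine if_congr Iff.rfl ?_ rfl
    simp [pathWeight, pathPoly]

theorem exists_polynomial_pathHom (a : GraphComb) :
    ∃ P : Polynomial ℝ, ∀ θ, paramEval (pathHom H₀ u q θ) a = P.eval θ := by
  have key : ∀ H, ∃ P : Polynomial ℝ, ∀ θ, pathHom H₀ u q θ H = P.eval θ := by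
    intro H
    obtain ⟨n, G, -, rfl⟩ := exists_ofFinite H
    refine ⟨∑ x : Fin n → Option (Option V₀), (∏ v, pathPoly q (x v)) *
      Polynomial.C (mixTerm (pathRel H₀) none u G x), fun θ => ?_⟩
    rw [pathHom, mixHom_ofFinite, mixSum, Polynomial.eval_finsetSum]
    refine Finset.sum_congr rfl fun x _ => ?_
    rw [Polynomial.eval_mul, Polynomial.eval_C, Polynomial.eval_prod]
    rfl
  choose P hP using key
  refine ⟨∑ H ∈ a.coeff.support, Polynomial.C (a.coeff H) * P H, fun θ => ?_⟩
  rw [paramEval_apply, Polynomial.eval_finsetSum]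
  refine Finset.sum_congr rfl fun H _ => ?_
  beta_reduce
  rw [Polynomial.eval_mul, Polynomial.eval_C, hP]

variable {u q} in
theorem IsReflPos.pathHom {d : ℕ} (hu : IsReflPos d u) (hq : ∀ v, 0 ≤ q v)
    (hq1 : ∑ v, q v ≤ 1) {θ : ℝ} (h0 : 0 ≤ θ) (h1 : θ ≤ 1) : IsReflPos d (pathHom H₀ u q θ) :=
  hu.mixHom _ _ _ _ (pathWeight_nonneg hq hq1 h0 h1)

end Path

/-! ### Homomorphism densities separate graph combinations -/

section Independence

open MvPolynomial

open Classical in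
/-- The generating function of the homomorphisms from `G` to `H₀`. -/
noncomputable def homPoly {V V₀ : Type} [Fintype V] [Fintype V₀] (G : SimpleGraph V)
    (H₀ : SimpleGraph V₀) : MvPolynomial V₀ ℝ :=
  ∑ y : V → V₀, if (∀ a b, G.Adj a b → H₀.Adj (y a) (y b)) then ∏ v, X (y v) else 0

variable {V V₀ : Type} [Fintype V]

theorem coeff_prod_X [DecidableEq V₀] (y : V → V₀) (m : V₀ →₀ ℕ) :
    coeff m (∏ v, X (y v) : MvPolynomial V₀ ℝ) =
      if ∑ v, Finsupp.single (y v) 1 = m then 1 else 0 := by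
  rw [← coeff_monomial, monomial_sum_one]
  rfl

variable [Fintype V₀]

theorem eval_homPoly {G : SimpleGraph V} (hG : ∀ v, v ∈ G.support) (H₀ : SimpleGraph V₀)
    (u : PLGraph Empty →* ℝ) (q : V₀ → ℝ) :
    eval q (homPoly G H₀) = pathHom H₀ u q 1 (ofFinite G) := by
  classical
  rw [pathHom_one H₀ u q hG, homPoly, map_sum]
  refine Finset.sum_congr rfl fun y _ => ?_
  split_ifs <;> simp

theorem injective_of_sum_single_eq {y : V → V₀}
    (h : ∑ v, Finsupp.single (y v) 1 = Finsupp.equivFunOnFinite.symm fun _ : V₀ => 1) :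
    Function.Injective y := by
  classical
  intro a b hab
  by_contra hne
  have h1 := DFunLike.congr_fun h (y a)
  rw [Finsupp.finsetSum_apply] at h1
  -- Two vertices with the same image would give that variable an exponent of at least 2.
  have h2 : ∑ v ∈ ({a, b} : Finset V), Finsupp.single (y v) 1 (y a) ≤
      ∑ v, Finsupp.single (y v) 1 (y a) :=
    Finset.sum_le_univ_sum_of_nonneg fun _ => Nat.zero_le _
  rw [h1, Finset.sum_pair hne, ← hab] at h2
  simp at h2

/-- The squarefree monomial in all vertices of `H₀` arises only from injective maps; such a
homomorphism from a graph with at least as many edges would identify the two graphs. -/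
theorem coeff_homPoly_eq_zero {G : SimpleGraph V} {H₀ : SimpleGraph V₀}
    (hne : ofFinite G ≠ ofFinite H₀) (hcard : (ofFinite H₀).numEdges ≤ (ofFinite G).numEdges) :
    coeff (Finsupp.equivFunOnFinite.symm fun _ => 1) (homPoly G H₀) = 0 := by
  classical
  rw [numEdges_ofFinite, numEdges_ofFinite] at hcard
  rw [homPoly, coeff_sum]
  refine Finset.sum_eq_zero fun y _ => ?_
  split_ifs with hy
  · rw [coeff_prod_X, if_neg]
    intro h
    exact hne (ofFinite_eq_of_injective_hom (injective_of_sum_single_eq h) hy hcard)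
  · exact coeff_zero _

/-- The identity contributes 1 and no map contributes negatively. -/
theorem coeff_homPoly_self_pos (H₀ : SimpleGraph V₀) :
    0 < coeff (Finsupp.equivFunOnFinite.symm fun _ => 1) (homPoly H₀ H₀) := by
  classical
  rw [homPoly, coeff_sum]
  refine Finset.sum_pos' (fun y _ => ?_) ⟨id, Finset.mem_univ _, ?_⟩
  · split_ifs
    · rw [coeff_prod_X]
      split_ifs <;> norm_num
    · rw [coeff_zero]
  · have hid : ∀ a b, H₀.Adj a b → H₀.Adj (id a) (id b) := fun a b h => h
    rw [if_pos hid, coeff_prod_X, if_pos]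
    · exact one_pos
    · ext v
      rw [Finsupp.finsetSum_apply]
      simp [Finsupp.single_apply]

end Independence

/-- Homomorphism densities separate graph combinations. -/
theorem exists_pathHom_one_ne_zero {b : GraphComb} (hb : b ≠ 0) (u : PLGraph Empty →* ℝ) :
    ∃ (n : ℕ) (H₀ : SimpleGraph (Fin n)) (q : Fin n → ℝ), (∀ v, 0 ≤ q v) ∧ ∑ v, q v ≤ 1 ∧
      paramEval (pathHom H₀ u q 1) b ≠ 0 := by
  classical
  have hsupp : b.coeff.support.Nonempty :=
    Finsupp.support_nonempty_iff.2 fun h => hb (MonoidAlgebra.coeff_eq_zero.1 h)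
  -- With `H` of fewest edges as target, no other graph in the support of `b` contributes to the
  -- squarefree monomial, so nothing can cancel the term of `H`.
  obtain ⟨H, hH, hmin⟩ := Finset.exists_min_image b.coeff.support numEdges hsupp
  choose k G hG hGH using exists_ofFinite
  let m : Fin (k H) →₀ ℕ := Finsupp.equivFunOnFinite.symm fun _ => 1
  let B : MvPolynomial (Fin (k H)) ℝ :=
    ∑ F ∈ b.coeff.support, MvPolynomial.C (b.coeff F) * homPoly (G F) (G H)
  have hB : B ≠ 0 := by
    intro h0
    have h1 : MvPolynomial.coeff m B = 0 := by rw [h0, MvPolynomial.coeff_zero]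
    rw [MvPolynomial.coeff_sum, Finset.sum_eq_single H] at h1
    · rw [MvPolynomial.coeff_C_mul] at h1
      exact (mul_ne_zero (Finsupp.mem_support_iff.1 hH) (coeff_homPoly_self_pos (G H)).ne') h1
    · intro F hF hne
      rw [MvPolynomial.coeff_C_mul, coeff_homPoly_eq_zero, mul_zero]
      · rwa [hGH, hGH]
      · rw [hGH, hGH]
        exact hmin F hF
    · exact fun h => (h hH).elim
  -- A nonzero polynomial cannot vanish on a box with infinite sides. The side `1 / (k H + 1)` keeps
  -- the total weight at most 1, and the dead colour absorbs the rest.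
  have hex : ∃ q ∈ Set.pi Set.univ fun _ : Fin (k H) => Set.Icc (0 : ℝ) (1 / (k H + 1)),
      MvPolynomial.eval q B ≠ 0 := by
    by_contra! hcon
    have hpos : (0 : ℝ) < 1 / (k H + 1) := by positivity
    refine hB (MvPolynomial.funext_set _ (fun _ => Set.Icc_infinite hpos) ?_)
    intro x hx
    rw [hcon x hx, map_zero]
  obtain ⟨q, hq, hqB⟩ := hex
  refine ⟨k H, G H, q, fun v => (hq v trivial).1, ?_, ?_⟩
  · refine (Finset.sum_le_card_nsmul Finset.univ q _ fun v _ => (hq v trivial).2).trans ?_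
    rw [Finset.card_univ, Fintype.card_fin, nsmul_eq_mul, mul_one_div, div_le_one (by positivity)]
    linarith
  · convert hqB using 1
    rw [paramEval_apply, map_sum]
    refine Finset.sum_congr rfl fun F _ => ?_
    beta_reduce
    rw [map_mul, MvPolynomial.eval_C, eval_homPoly (hG F) _ u, hGH]

/-! ### Continuity along the path and the conclusion -/

theorem Polynomial.eval_zero_nonneg_of_mul {P Q : Polynomial ℝ} (hQ : Q ≠ 0)
    (hQ0 : ∀ θ, 0 ≤ θ → θ ≤ 1 → 0 ≤ Q.eval θ)
    (hPQ : ∀ θ, 0 ≤ θ → θ ≤ 1 → 0 ≤ P.eval θ * Q.eval θ) : 0 ≤ P.eval 0 := by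
  by_contra! hneg
  have hev : ∀ᶠ θ in nhds (0 : ℝ), P.eval θ < 0 :=
    P.continuous.continuousAt.eventually (gt_mem_nhds hneg)
  obtain ⟨δ, hδ, hball⟩ := Metric.eventually_nhds_iff.1 hev
  -- If `P(0) < 0`, then `P < 0` on a short interval, which contains a point that is not one of the
  -- finitely many roots of `Q`; there the product is negative.
  obtain ⟨θ, hθ, hroot⟩ := (Set.Ioo_infinite (lt_min hδ one_pos)).exists_notMem_finite
    (Q.roots.toFinset.finite_toSet)
  have hθ1 : θ ≤ 1 := (hθ.2.trans_le (min_le_right _ _)).le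
  have hP : P.eval θ < 0 := by
    apply hball
    rw [Real.dist_eq, sub_zero, abs_of_pos hθ.1]
    exact hθ.2.trans_le (min_le_left _ _)
  have hQθ : Q.eval θ ≠ 0 := by
    intro h
    apply hroot
    simp [hQ, h]
  exact absurd (hPQ θ hθ.1.le hθ1)
    (mul_neg_of_neg_of_pos hP ((hQ0 θ hθ.1.le hθ1).lt_of_ne' hQθ)).not_ge

theorem IsReflPos.paramEval_nonneg_of_nonneg_on_sosProfile {d e : ℕ} (hde : d ≤ e)
    {u : PLGraph Empty →* ℝ} (hu : IsReflPos e u) {a : GraphComb}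
    (ha : ∀ H ∈ a.coeff.support, ∀ C ∈ H.components, C ∈ sosGraphs d)
    (hpos : ∀ v ∈ sosProfile d, 0 ≤ a.evalAt v) : 0 ≤ paramEval u a := by
  rw [← evalAt_restrict u ha]
  exact hpos _ (hu.mono hde).restrict_mem

/-- A connected graph with at most `d` edges lies in `sosGraphs d`, as its own product with the
empty graph. -/
theorem exists_components_mem_sosGraphs (a : GraphComb) :
    ∃ d, ∀ H ∈ a.coeff.support, ∀ C ∈ H.components, C ∈ sosGraphs d := by
  classical
  refine ⟨a.coeff.support.sup fun H => (H.components.map numEdges).sum, fun H hH C hC => ?_⟩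
  refine mem_sosGraphs (conn_of_mem_components hC) (le_trans ?_
    (Finset.le_sup (f := fun H : PLGraph Empty => (H.components.map numEdges).sum) hH))
  exact Multiset.single_le_sum (fun _ _ => Nat.zero_le _) _ (Multiset.mem_map_of_mem _ hC)

theorem theorem4 (a b c : GraphComb) (hb0 : b ≠ 0) (hb : b.IsSosTestable)
    (hc : c.IsSosTestable) (habc : a * b = c) : a.IsSosTestable := by
  obtain ⟨d₁, hd₁, hbV, hbpos⟩ := hb
  obtain ⟨d₂, -, hcV, hcpos⟩ := hc
  obtain ⟨d₃, haV⟩ := exists_components_mem_sosGraphs a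
  have h1 : d₁ ≤ max d₁ (max d₂ d₃) := le_max_left _ _
  have h2 : d₂ ≤ max d₁ (max d₂ d₃) := (le_max_left _ _).trans (le_max_right _ _)
  have h3 : d₃ ≤ max d₁ (max d₂ d₃) := (le_max_right _ _).trans (le_max_right _ _)
  refine ⟨max d₁ (max d₂ d₃), hd₁.trans h1,
    fun H hH C hC => sosGraphs_mono h3 (haV H hH C hC), fun v hv => ?_⟩
  have hu := isReflPos_of_mem_sosProfile hv
  rw [GraphComb.evalAt, ← paramEval_extHom]
  -- Only reflection positivity is used from here on; the values of `u` outside `sosGraphs` are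
  -- irrelevant.
  generalize extHom (Function.extend Subtype.val v 0) = u at hu
  obtain ⟨n, H₀, q, hq0, hq1, hne⟩ := exists_pathHom_one_ne_zero hb0 u
  obtain ⟨P, hP⟩ := exists_polynomial_pathHom H₀ u q a
  obtain ⟨Q, hQ⟩ := exists_polynomial_pathHom H₀ u q b
  rw [← pathHom_zero H₀ u q, hP]
  refine Polynomial.eval_zero_nonneg_of_mul (Q := Q) ?_ (fun θ h0 h1' => ?_) fun θ h0 h1' => ?_
  · rintro rfl
    exact hne (by rw [hQ, Polynomial.eval_zero])
  · rw [← hQ]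
    exact (hu.pathHom H₀ hq0 hq1 h0 h1').paramEval_nonneg_of_nonneg_on_sosProfile h1 hbV hbpos
  · rw [← hP, ← hQ, ← map_mul, habc]
    exact (hu.pathHom H₀ hq0 hq1 h0 h1').paramEval_nonneg_of_nonneg_on_sosProfile h2 hcV hcpos
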